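/- Let $(\mathcal K,[\cdot,\cdot])$ be a Krein space, let $\mathcal H$ and $\mathcal H_1,\dots,\mathcal H_m$ be complex Hilbert spaces, and let $T:\mathcal H\to\mathcal K$, $T_j:\mathcal H_j\to\mathcal K$ and $R_j:\mathcal H_j\to\mathcal H$ be bounded, linear and injective with $TR_j=T_j$ for $j=1,\dots,m$. For a bounded operator $S$ denote by $S^+$ its Krein space adjoint (the usual adjoint $S^*$ between Hilbert spaces), and by $D'$ the commutant of an operator $D$, i.e. the algebra of all bounded operators commuting with $D$. Whenever $S$ is a bounded injective operator from a Hilbert space to a Krein (or Hilbert) space and $C\in(SS^+)'$, the operator $S^{-1}CS$ is everywhere defined and bounded, and belongs to $(S^+S)'$. Put $$\Theta(C)=T^{-1}CT\ \ (C\in (TT^+)'),\qquad \Theta_j(C)=T_j^{-1}CT_j\ \ (C\in (T_jT_j^+)'),\qquad \Gamma_j(D)=R_j^{-1}DR_j\ \ (D\in (R_jR_j^*)').$$ Let $j\in\{1,\dots,m\}$ and let $N$ be a bounded operator on $\mathcal K$ which is normal, i.e. $NN^+=N^+N$, and satisfies $N\in (T_jT_j^+)'\cap (TT^+)'$. Then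 $\Theta(N)$ is a normal operator on $\mathcal H$, $\Theta_j(N)$ is a normal operator on $\mathcal H_j$, and $\sigma(\Theta_j(N))\subseteq\sigma(\Theta(N))$. Let $E$ and $E_j$ be the spectral measures of $\Theta(N)$ and $\Theta_j(N)$, respectively. 1. For every Borel set $\Delta\subseteq\mathbb C$ one has $E(\Delta)\in (R_jR_j^*)'\cap (T^+T)'$, $E_j(\Delta)\in (R_j^*R_j)'\cap (T_j^+T_j)'$, and $$\Gamma_j(E(\Delta))=E_j(\Delta).$$ 2. For every bounded and measurable function $h:\sigma(\Theta(N))\to\mathbb C$ one has $\int_{\sigma(\Theta(N))} h\,dE\in (R_jR_j^*)'\cap (T^+T)'$, $\int_{\sigma(\Theta_j(N))} h\,dE_j\in (R_j^*R_j)'\cap (T_j^+T_j)'$, and $$\Gamma_j\left(\int_{\sigma(\Theta(N))} h\,dE\right)=\int_{\sigma(\Theta_j(N))} h\,dE_j .$$ -/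

import Mathlib

open scoped InnerProductSpace ComplexConjugate
open MeasureTheory

noncomputable section

/-- A Krein space: a complex vector space with a Hermitian form `[x, y]` (conjugate-linear in `x`,
linear in `y`) which possesses a fundamental symmetry `J`, i.e. `J² = 1`, `[J x, y] = [x, J y]`, and
`[J x, y]` is a Hilbert space scalar product.  The norm carried by the type is any complete norm
defining the topology of the Krein space: it is equivalent to `√[J x, x]` (the upper estimate
is contained in the continuity of the form and of `J`). -/
class KreinSpace (K : Type*) [NormedAddCommGroup K] [NormedSpace ℂ K] extends
    CompleteSpace K where
  form : K →L⋆[ℂ] K →L[ℂ] ℂ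
  conj_form : ∀ x y, conj (form x y) = form y x
  exists_fundamentalSymmetry : ∃ J : K →L[ℂ] K, (∀ x, J (J x) = x) ∧
    (∀ x y, form (J x) y = form x (J y)) ∧
    ∃ c : ℝ, 0 < c ∧ ∀ x, c * ‖x‖ ^ 2 ≤ (form (J x) x).re

/-- Every Hilbert space is a Krein space, with its scalar product as form and `J = 1`. -/
instance KreinSpace.ofHilbert (H : Type*) [NormedAddCommGroup H] [InnerProductSpace ℂ H]
    [CompleteSpace H] : KreinSpace H where
  form := innerSL ℂ
  conj_form x y := by simp
  exists_fundamentalSymmetry := ⟨1, fun _ => rfl, fun _ _ => rfl, 1, one_pos, fun x => by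
    simp only [one_mul, one_apply_eq_self, innerSL_apply_apply]
    exact (inner_self_eq_norm_sq (𝕜 := ℂ) x).ge⟩

namespace KreinSpace

theorem exists_inner_eq_of_core {F : Type*} [AddCommGroup F] [Module ℂ F] [TopologicalSpace F]
    [IsTopologicalAddGroup F] [ContinuousConstSMul ℂ F] (cd : InnerProductSpace.Core ℂ F)
    (h : ContinuousAt (fun v : F => cd.inner v v) 0)
    (h' : Bornology.IsVonNBounded ℂ {v : F | RCLike.re (cd.inner v v) < 1})
    (hF : @CompleteSpace F (IsTopologicalAddGroup.rightUniformSpace F)) (f : StrongDual ℂ F) :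
    ∃ y, ∀ x, cd.inner y x = f x := by
  let i1 : NormedAddCommGroup F := cd.toNormedAddCommGroupOfTopology h h'
  let i2 : InnerProductSpace ℂ F := InnerProductSpace.ofCoreOfTopology cd h h'
  have hc : CompleteSpace F := by
    rw [IsUniformAddGroup.rightUniformSpace_eq (G := F)] at hF
    exact hF
  exact ⟨(InnerProductSpace.toDual ℂ F).symm f,
    fun x => InnerProductSpace.toDual_symm_apply (𝕜 := ℂ) (E := F)⟩

section Riesz

variable {K : Type*} [NormedAddCommGroup K] [NormedSpace ℂ K] [KreinSpace K]

/-- Riesz representation in a Krein space. -/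
theorem form_bijective : Function.Bijective (form (K := K)) := by
  obtain ⟨J, hJJ, hJ, c, hc, hcJ⟩ := exists_fundamentalSymmetry (K := K)
  have hpos : ∀ x : K, 0 ≤ (form (J x) x).re := fun x => le_trans (by positivity) (hcJ x)
  let core : InnerProductSpace.Core ℂ K :=
    { inner := fun x y => form (J x) y
      conj_inner_symm := fun x y => by
        change conj (form (J y) x) = form (J x) y
        rw [conj_form, hJ]
      re_inner_nonneg := hpos
      add_left := fun x y z => by simp
      smul_left := fun x y r => by simp
      definite := fun x hx => by
        have h0 : form (J x) x = 0 := hx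
        have := hcJ x
        rw [h0] at this
        have h2 : ‖x‖ ^ 2 ≤ 0 := by
          by_contra h
          push Not at h
          have := mul_pos hc h
          simp at *
          linarith
        have : ‖x‖ = 0 := by nlinarith [norm_nonneg x]
        simpa using this }
  have hcont : ContinuousAt (fun x : K => form (J x) x) 0 := by fun_prop
  have hbdd : Bornology.IsVonNBounded ℂ {v : K | (form (J v) v).re < 1} := by
    rw [NormedSpace.isVonNBounded_iff ℂ, isBounded_iff_forall_norm_le]
    refine ⟨1 / c + 1, fun x hx => ?_⟩
    have h1 := hcJ x
    have h2 : (form (J x) x).re < 1 := hx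
    have h3 : c * ‖x‖ ^ 2 < 1 := h1.trans_lt h2
    have h4 : ‖x‖ ^ 2 < 1 / c := by rw [lt_div_iff₀ hc]; linarith
    nlinarith [norm_nonneg x, sq_nonneg (‖x‖ - 1)]
  have hK : @CompleteSpace K (IsTopologicalAddGroup.rightUniformSpace K) := by
    rw [IsUniformAddGroup.rightUniformSpace_eq]
    infer_instance
  constructor
  · intro x y hxy
    have h0 : form (J (J (x - y))) (J (x - y)) = 0 := by
      simp [hJJ, hxy]
    have h1 := core.definite _ h0
    have h2 := hJJ (x - y)
    rw [h1, map_zero] at h2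
    exact (sub_eq_zero.mp h2.symm)
  · intro f
    obtain ⟨y, hy⟩ := exists_inner_eq_of_core core hcont hbdd hK f
    exact ⟨J y, ContinuousLinearMap.ext hy⟩

/-- The isomorphism `x ↦ [x, ·]` of a Krein space onto its (conjugate) dual. -/
def toDual (K : Type*) [NormedAddCommGroup K] [NormedSpace ℂ K] [KreinSpace K] :
    K ≃L⋆[ℂ] StrongDual ℂ K :=
  ContinuousLinearEquiv.ofBijective form
    (LinearMap.ker_eq_bot.mpr form_bijective.1) (LinearMap.range_eq_top.mpr form_bijective.2)

theorem form_toDual_symm (f : StrongDual ℂ K) (x : K) : form ((toDual K).symm f) x = f x := by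
  have h : toDual K ((toDual K).symm f) = f := (toDual K).apply_symm_apply f
  exact congrArg (fun g : StrongDual ℂ K => g x) h

theorem form_ext_left {x y : K} (h : ∀ z, form x z = form y z) : x = y :=
  form_bijective.1 (ContinuousLinearMap.ext h)

theorem form_ext_right {x y : K} (h : ∀ z, form z x = form z y) : x = y :=
  form_ext_left fun z => by rw [← conj_form z x, ← conj_form z y, h]

end Riesz

variable {K₁ K₂ : Type*} [NormedAddCommGroup K₁] [NormedSpace ℂ K₁] [KreinSpace K₁]
  [NormedAddCommGroup K₂] [NormedSpace ℂ K₂] [KreinSpace K₂]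

/-- The Krein space adjoint `T⁺` of a bounded operator `T`, i.e. `[T x, y] = [x, T⁺ y]`. -/
def adjoint (T : K₁ →L[ℂ] K₂) : K₂ →L[ℂ] K₁ :=
  (toDual K₁).symm.toContinuousLinearMap.comp
    ((((ContinuousLinearMap.compL ℂ K₁ K₂ ℂ).flip T).comp form : K₂ →L⋆[ℂ] StrongDual ℂ K₁))

theorem form_adjoint_left (T : K₁ →L[ℂ] K₂) (x : K₂) (y : K₁) :
    form (adjoint T x) y = form x (T y) :=
  form_toDual_symm _ _

theorem form_adjoint_right (T : K₁ →L[ℂ] K₂) (x : K₁) (y : K₂) :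
    form x (adjoint T y) = form (T x) y := by
  rw [← conj_form, form_adjoint_left, conj_form]

/-- For operators between Hilbert spaces the Krein space adjoint is the usual adjoint. -/
theorem adjoint_eq_hilbert_adjoint {H₁ H₂ : Type*} [NormedAddCommGroup H₁]
    [InnerProductSpace ℂ H₁] [CompleteSpace H₁] [NormedAddCommGroup H₂] [InnerProductSpace ℂ H₂]
    [CompleteSpace H₂] (T : H₁ →L[ℂ] H₂) : adjoint T = ContinuousLinearMap.adjoint T :=
  ContinuousLinearMap.ext fun y => form_ext_right fun z =>
    (form_adjoint_right T z y).trans (ContinuousLinearMap.adjoint_inner_right T z y).symm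

/-- The commutant `D'` of a bounded operator `D`. -/
abbrev commutant {K : Type*} [NormedAddCommGroup K] [NormedSpace ℂ K] (D : K →L[ℂ] K) :
    Subalgebra ℂ (K →L[ℂ] K) :=
  Subalgebra.centralizer ℂ {D}

theorem mem_commutant {K : Type*} [NormedAddCommGroup K] [NormedSpace ℂ K] {D C : K →L[ℂ] K} :
    C ∈ commutant D ↔ D * C = C * D := by
  simp [Subalgebra.mem_centralizer_iff]

section Transport

variable {K H : Type*} [NormedAddCommGroup K] [NormedSpace ℂ K] [KreinSpace K]
  [NormedAddCommGroup H] [InnerProductSpace ℂ H] [CompleteSpace H]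

theorem norm_adjoint_comp_le {T : H →L[ℂ] K} {C : K →L[ℂ] K}
    (hC : C ∈ commutant (T ∘L adjoint T)) :
    ∃ M : ℝ, ∀ x, ‖adjoint T (C x)‖ ≤ M * ‖adjoint T x‖ := by
  have hC' : ∀ x, T (adjoint T (C x)) = C (T (adjoint T x)) := fun x =>
    congrArg (fun D : K →L[ℂ] K => D x) (mem_commutant.mp hC)
  have hin : ∀ x y : K, ⟪adjoint T x, adjoint T y⟫_ℂ = form x (T (adjoint T y)) := fun x y =>
    form_adjoint_left T x (adjoint T y)
  have hin' : ∀ x y : K, ⟪adjoint T x, adjoint T y⟫_ℂ = form (T (adjoint T x)) y := fun x y =>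
    form_adjoint_right T (adjoint T x) y
  let S : K →L[ℂ] K := adjoint C ∘L C
  have hS : ∀ x y, ⟪adjoint T (S x), adjoint T y⟫_ℂ
      = ⟪adjoint T (C x), adjoint T (C y)⟫_ℂ := fun x y => by
    rw [hin, hin, hC', ← form_adjoint_left C]
    rfl
  have hS' : ∀ x y, ⟪adjoint T x, adjoint T (S y)⟫_ℂ
      = ⟪adjoint T (C x), adjoint T (C y)⟫_ℂ := fun x y => by
    rw [hin', hin', hC', ← form_adjoint_right C]
    rfl
  -- logarithmic convexity of the norms of the iterates of `S`
  have key : ∀ x, ‖adjoint T (S x)‖ ^ 2 ≤ ‖adjoint T x‖ * ‖adjoint T (S (S x))‖ := fun x => by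
    have h1 : ⟪adjoint T (S x), adjoint T (S x)⟫_ℂ = ⟪adjoint T x, adjoint T (S (S x))⟫_ℂ := by
      rw [hS, hS']
    have h2 := inner_self_eq_norm_sq_to_K (𝕜 := ℂ) (adjoint T (S x))
    rw [h1] at h2
    have h3 := norm_inner_le_norm (𝕜 := ℂ) (adjoint T x) (adjoint T (S (S x)))
    rw [h2] at h3
    simpa using h3
  have hSb : ∀ x, ‖adjoint T (S x)‖ ≤ ‖S‖ * ‖adjoint T x‖ := fun x => by
    by_contra! hlt
    let u : ℕ → ℝ := fun n => ‖adjoint T ((S ^ n) x)‖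
    have hu : ∀ n, u (n + 1) ^ 2 ≤ u n * u (n + 2) := fun n => by
      have := key ((S ^ n) x)
      simpa only [u, pow_succ', mul_apply_eq_comp] using this
    have hu0 : 0 < u 0 := by
      by_contra! h0
      have h0' : u 0 = 0 := le_antisymm h0 (norm_nonneg _)
      have := hu 0
      rw [h0', zero_mul] at this
      have h1 : u 1 = 0 := by
        have : u 1 ^ 2 = 0 := le_antisymm this (sq_nonneg _)
        simpa using this
      have h0'' : ‖adjoint T x‖ = 0 := by simpa [u] using h0'
      have h1' : ‖adjoint T (S x)‖ = 0 := by simpa [u] using h1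
      rw [h0'', h1', mul_zero] at hlt
      exact lt_irrefl _ hlt
    set r : ℝ := u 1 / u 0 with hr
    have hrS : ‖S‖ < r := by
      rw [hr, lt_div_iff₀ hu0]
      simpa [u] using hlt
    have hr0 : 0 < r := (norm_nonneg _).trans_lt hrS
    have hstep : ∀ n, 0 < u n ∧ r * u n ≤ u (n + 1) := fun n => by
      induction n with
      | zero => exact ⟨hu0, by rw [hr, div_mul_cancel₀ _ hu0.ne']⟩
      | succ n ih =>
        obtain ⟨h1, h2⟩ := ih
        have h3 : 0 < u (n + 1) := lt_of_lt_of_le (mul_pos hr0 h1) h2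
        refine ⟨h3, ?_⟩
        have h4 := hu n
        have h5 : r * u n * u (n + 1) ≤ u (n + 1) ^ 2 := by
          rw [sq]
          exact mul_le_mul_of_nonneg_right h2 h3.le
        have h6 : u n * (r * u (n + 1)) ≤ u n * u (n + 2) := by linarith
        exact le_of_mul_le_mul_left h6 h1
    have hlow : ∀ n, r ^ n * u 0 ≤ u n := fun n => by
      induction n with
      | zero => simp
      | succ n ih =>
        calc r ^ (n + 1) * u 0 = r * (r ^ n * u 0) := by ring
          _ ≤ r * u n := by gcongr
          _ ≤ u (n + 1) := (hstep n).2
    have hup : ∀ n, u n ≤ ‖adjoint T‖ * ‖x‖ * ‖S‖ ^ n := fun n => by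
      induction n with
      | zero => simpa [u] using (adjoint T).le_opNorm x
      | succ n ih =>
        calc u (n + 1) ≤ ‖adjoint T‖ * ‖(S ^ (n + 1)) x‖ := (adjoint T).le_opNorm _
          _ ≤ ‖adjoint T‖ * (‖S ^ (n + 1)‖ * ‖x‖) := by gcongr; exact (S ^ (n + 1)).le_opNorm x
          _ ≤ ‖adjoint T‖ * (‖S‖ ^ (n + 1) * ‖x‖) := by
              gcongr; exact norm_pow_le' S (Nat.succ_pos n)
          _ = _ := by ring
    have hlim : Filter.Tendsto (fun n : ℕ => ‖adjoint T‖ * ‖x‖ * (‖S‖ / r) ^ n) Filter.atTop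
        (nhds (‖adjoint T‖ * ‖x‖ * 0)) :=
      (tendsto_pow_atTop_nhds_zero_of_lt_one (by positivity)
        ((div_lt_one hr0).mpr hrS)).const_mul _
    rw [mul_zero] at hlim
    refine absurd (ge_of_tendsto' hlim fun n => ?_) (not_le.mpr hu0)
    have h1 := (hlow n).trans (hup n)
    rw [div_pow, mul_div_assoc', le_div_iff₀ (pow_pos hr0 n)]
    linarith
  refine ⟨√‖S‖, fun x => ?_⟩
  have h1 : ‖adjoint T (C x)‖ ^ 2 ≤ ‖S‖ * ‖adjoint T x‖ ^ 2 := by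
    have h2 := inner_self_eq_norm_sq_to_K (𝕜 := ℂ) (adjoint T (C x))
    rw [← hS] at h2
    have h3 := norm_inner_le_norm (𝕜 := ℂ) (adjoint T (S x)) (adjoint T x)
    rw [h2] at h3
    have h4 : ‖adjoint T (C x)‖ ^ 2 ≤ ‖adjoint T (S x)‖ * ‖adjoint T x‖ := by simpa using h3
    nlinarith [hSb x, norm_nonneg (adjoint T x)]
  rw [← Real.sqrt_sq (norm_nonneg (adjoint T x)), ← Real.sqrt_mul (norm_nonneg _)]
  exact Real.le_sqrt_of_sq_le h1

theorem denseRange_adjoint {T : H →L[ℂ] K} (hT : Function.Injective T) :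
    DenseRange (adjoint T) := by
  have h : (adjoint T).range.topologicalClosure = ⊤ := by
    rw [Submodule.topologicalClosure_eq_top_iff, Submodule.eq_bot_iff]
    intro x hx
    apply hT
    rw [map_zero]
    refine form_ext_left fun y => ?_
    have h1 : ⟪x, adjoint T y⟫_ℂ = 0 :=
      (Submodule.mem_orthogonal' _ _).mp hx _ (LinearMap.mem_range_self _ y)
    rw [map_zero]
    exact (form_adjoint_right T x y).symm.trans h1
  intro x
  have : x ∈ (adjoint T).range.topologicalClosure := h ▸ Submodule.mem_top
  exact this

theorem exists_extension {X Y Z : Type*} [NormedAddCommGroup X] [NormedSpace ℂ X]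
    [NormedAddCommGroup Y] [NormedSpace ℂ Y] [NormedAddCommGroup Z] [NormedSpace ℂ Z]
    [CompleteSpace Z] (e : X →L[ℂ] Y) (f : X →L[ℂ] Z) (he : DenseRange e)
    (hf : ∃ M : ℝ, ∀ x, ‖f x‖ ≤ M * ‖e x‖) : ∃ D : Y →L[ℂ] Z, ∀ x, D (e x) = f x :=
  ⟨f.toLinearMap.extendOfNorm e.toLinearMap, fun x =>
    LinearMap.extendOfNorm_eq (f := f.toLinearMap) (e := e.toLinearMap) he hf x⟩

/-- For `C` in the commutant of `T T⁺` the operator `T⁻¹ C T` is everywhere defined and bounded,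
and it lies in the commutant of `T⁺ T`. -/
theorem exists_transport {T : H →L[ℂ] K} (hT : Function.Injective T) {C : K →L[ℂ] K}
    (hC : C ∈ commutant (T ∘L adjoint T)) :
    ∃ D : commutant (adjoint T ∘L T), ∀ x, T ((D : H →L[ℂ] H) x) = C (T x) := by
  have hC' : ∀ x, T (adjoint T (C x)) = C (T (adjoint T x)) := fun x =>
    congrArg (fun D : K →L[ℂ] K => D x) (mem_commutant.mp hC)
  obtain ⟨D, hD⟩ := exists_extension (adjoint T) (adjoint T ∘L C) (denseRange_adjoint hT)
    (by simpa only [ContinuousLinearMap.comp_apply] using norm_adjoint_comp_le hC)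
  simp only [ContinuousLinearMap.comp_apply] at hD
  have hTD : ∀ x, T (D x) = C (T x) := fun x => by
    have h : (fun x => T (D x)) = fun x => C (T x) :=
      (denseRange_adjoint hT).equalizer (T.continuous.comp D.continuous)
        (C.continuous.comp T.continuous)
        (funext fun x => by simp only [Function.comp, hD, hC'])
    exact congrFun h x
  refine ⟨⟨D, mem_commutant.mpr (ContinuousLinearMap.ext fun x => ?_)⟩, hTD⟩
  simp only [mul_apply_eq_comp, ContinuousLinearMap.comp_apply, hD, hTD]

/-- The map `(T T⁺)' → (T⁺ T)'`, `C ↦ (T × T)⁻¹(C) = T⁻¹ C T`, for a bounded injective operator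
`T` from a Hilbert space to a Krein space. -/
def transport (T : H →L[ℂ] K) (hT : Function.Injective T)
    (C : commutant (T ∘L adjoint T)) : commutant (adjoint T ∘L T) :=
  (exists_transport hT C.2).choose

theorem apply_transport (T : H →L[ℂ] K) (hT : Function.Injective T)
    (C : commutant (T ∘L adjoint T)) (x : H) :
    T ((transport T hT C : H →L[ℂ] H) x) = (C : K →L[ℂ] K) (T x) :=
  (exists_transport hT C.2).choose_spec x

end Transport

end KreinSpace

theorem ext_quadratic {H : Type*} [NormedAddCommGroup H] [InnerProductSpace ℂ H]
    {A B : H →L[ℂ] H} (h : ∀ x, ⟪x, A x⟫_ℂ = ⟪x, B x⟫_ℂ) : A = B := by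
  have h1 : (A : H →ₗ[ℂ] H) = (B : H →ₗ[ℂ] H) := (ext_inner_map _ _).mp fun x => by
    have := congrArg conj (h x)
    simpa using this
  exact ContinuousLinearMap.coe_injective h1

section Weak

variable {H : Type*} [NormedAddCommGroup H] [InnerProductSpace ℂ H] [CompleteSpace H]

/-- If the quadratic forms of a sequence of bounded operators converge pointwise, then the sequence
converges in the weak operator topology. -/
theorem exists_tendsto_weakly (A' : ℕ → H →L[ℂ] H) (q : H → ℂ)
    (h' : ∀ x, Filter.Tendsto (fun n => ⟪x, A' n x⟫_ℂ) Filter.atTop (nhds (q x))) :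
    ∃ B : H →L[ℂ] H, ∀ x y,
      Filter.Tendsto (fun n => ⟪x, A' n y⟫_ℂ) Filter.atTop (nhds ⟪x, B y⟫_ℂ) := by
  let A : ℕ → H →L[ℂ] H := fun n => ContinuousLinearMap.adjoint (A' n)
  have h : ∀ x, Filter.Tendsto (fun n => ⟪A n x, x⟫_ℂ) Filter.atTop (nhds (q x)) := fun x => by
    simpa only [A, ContinuousLinearMap.adjoint_inner_left] using h' x

  have h1 : ∀ x y, ∃ b, Filter.Tendsto (fun n => ⟪A n x, y⟫_ℂ) Filter.atTop (nhds b) :=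
    fun x y => by
      refine ⟨(q (x + y) - q (x - y) - Complex.I * q (x + Complex.I • y)
        + Complex.I * q (x - Complex.I • y)) / 4, ?_⟩
      have e : (fun n => ⟪A n x, y⟫_ℂ) = fun n => (⟪A n (x + y), x + y⟫_ℂ
          - ⟪A n (x - y), x - y⟫_ℂ
          - Complex.I * ⟪A n (x + Complex.I • y), x + Complex.I • y⟫_ℂ
          + Complex.I * ⟪A n (x - Complex.I • y), x - Complex.I • y⟫_ℂ) / 4 :=
        funext fun n => inner_map_polarization' (A n : H →ₗ[ℂ] H) x y
      rw [e]
      exact ((((h _).sub (h _)).sub ((h _).const_mul _)).add ((h _).const_mul _)).div_const _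
  choose b hb using h1
  have h2 : ∀ x, ∃ C, ∀ n, ‖A n x‖ ≤ C := fun x => by
    obtain ⟨C, hC⟩ := banach_steinhaus (g := fun n => innerSL ℂ (A n x)) fun y => by
      obtain ⟨C, hC⟩ := (hb x y).norm.bddAbove_range
      exact ⟨C, fun n => by simpa using hC (Set.mem_range_self n)⟩
    exact ⟨C, fun n => by simpa using hC n⟩
  obtain ⟨C, hC⟩ := banach_steinhaus h2
  have hbound : ∀ x y, ‖b x y‖ ≤ C * ‖x‖ * ‖y‖ := fun x y => by
    refine le_of_tendsto (hb x y).norm (Filter.Eventually.of_forall fun n => ?_)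
    refine (norm_inner_le_norm _ _).trans ?_
    gcongr
    exact (A n).le_of_opNorm_le (hC n) x
  let B : H →L⋆[ℂ] H →L[ℂ] ℂ := LinearMap.mkContinuous₂
    (LinearMap.mk₂'ₛₗ (starRingEnd ℂ) (RingHom.id ℂ) b
      (fun x x' y => tendsto_nhds_unique (hb _ _) (by
        simpa [inner_add_left] using (hb x y).add (hb x' y)))
      (fun c x y => tendsto_nhds_unique (hb _ _) (by
        simpa [inner_smul_left, mul_comm] using (hb x y).const_mul (conj c)))
      (fun x y y' => tendsto_nhds_unique (hb _ _) (by
        simpa [inner_add_right] using (hb x y).add (hb x y')))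
      (fun c x y => tendsto_nhds_unique (hb _ _) (by
        simpa [inner_smul_right] using (hb x y).const_mul c))) C hbound
  refine ⟨ContinuousLinearMap.adjoint (InnerProductSpace.continuousLinearMapOfBilin B),
    fun x y => ?_⟩
  have e : ⟪x, ContinuousLinearMap.adjoint (InnerProductSpace.continuousLinearMapOfBilin B) y⟫_ℂ
      = b x y := by
    rw [ContinuousLinearMap.adjoint_inner_right,
      InnerProductSpace.continuousLinearMapOfBilin_apply]
    rfl
  rw [e]
  simpa only [A, ContinuousLinearMap.adjoint_inner_left] using hb x y

end Weak

/-- A spectral measure on `ℂ`: a map `E` assigning orthogonal projections of the Hilbert space `H`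
to the Borel subsets of `ℂ`, with `E(ℂ) = 1`, multiplicative and countably additive in the strong
operator topology.  (Only the values on Borel sets are meaningful.) -/
structure SpectralMeasure (H : Type*) [NormedAddCommGroup H] [InnerProductSpace ℂ H]
    [CompleteSpace H] where
  proj : Set ℂ → H →L[ℂ] H
  isStarProjection : ∀ Δ, MeasurableSet Δ → IsStarProjection (proj Δ)
  proj_univ : proj Set.univ = 1
  proj_inter : ∀ Δ₁ Δ₂, MeasurableSet Δ₁ → MeasurableSet Δ₂ →
    proj (Δ₁ ∩ Δ₂) = proj Δ₁ * proj Δ₂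
  proj_iUnion : ∀ Δ : ℕ → Set ℂ, (∀ n, MeasurableSet (Δ n)) → Pairwise (Function.onFun Disjoint Δ) →
    ∀ x, HasSum (fun n => proj (Δ n) x) (proj (⋃ n, Δ n) x)

namespace SpectralMeasure

variable {H : Type*} [NormedAddCommGroup H] [InnerProductSpace ℂ H] [CompleteSpace H]

instance : CoeFun (SpectralMeasure H) (fun _ => Set ℂ → H →L[ℂ] H) := ⟨proj⟩

variable (E : SpectralMeasure H)

theorem inner_proj (x : H) {Δ : Set ℂ} (hΔ : MeasurableSet Δ) :
    ⟪x, E Δ x⟫_ℂ = (‖E Δ x‖ : ℂ) ^ 2 := by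
  have h := E.isStarProjection Δ hΔ
  have h1 : E Δ (E Δ x) = E Δ x := congrArg (fun D : H →L[ℂ] H => D x) h.isIdempotentElem
  have h2 := ContinuousLinearMap.adjoint_inner_left (E Δ) (E Δ x) x
  rw [← ContinuousLinearMap.star_eq_adjoint, h.isSelfAdjoint.star_eq, h1] at h2
  rw [← h2, inner_self_eq_norm_sq_to_K]
  rfl

theorem proj_empty_apply (x : H) : E ∅ x = 0 := by
  have h := E.proj_iUnion (fun _ => ∅) (fun _ => MeasurableSet.empty)
    (fun _ _ _ => disjoint_bot_left) x
  simpa using summable_const_iff _ |>.mp h.summable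

/-- The finite positive Borel measure `Δ ↦ (E(Δ) x, x) = ‖E(Δ) x‖²`. -/
def scalarMeasure (x : H) : Measure ℂ :=
  Measure.ofMeasurable (fun Δ _ => ENNReal.ofReal (‖E Δ x‖ ^ 2))
    (by simp [proj_empty_apply])
    (fun Δ hΔ hd => by
      have h1 := (innerSL ℂ x).hasSum (E.proj_iUnion Δ hΔ hd x)
      simp only [innerSL_apply_apply, E.inner_proj x (hΔ _),
        E.inner_proj x (MeasurableSet.iUnion hΔ)] at h1
      have h2 : HasSum (fun n => ‖E (Δ n) x‖ ^ 2) (‖E (⋃ n, Δ n) x‖ ^ 2) := by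
        exact_mod_cast h1
      rw [← h2.tsum_eq, ENNReal.ofReal_tsum_of_nonneg (fun n => sq_nonneg _) h2.summable])

theorem scalarMeasure_apply (x : H) {Δ : Set ℂ} (hΔ : MeasurableSet Δ) :
    E.scalarMeasure x Δ = ENNReal.ofReal (‖E Δ x‖ ^ 2) :=
  Measure.ofMeasurable_apply Δ hΔ

instance (x : H) : IsFiniteMeasure (E.scalarMeasure x) :=
  ⟨by rw [E.scalarMeasure_apply x MeasurableSet.univ]; exact ENNReal.ofReal_lt_top⟩

/-- Existence of `∫ h dE` for bounded measurable `h`. -/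
theorem exists_integral (h : ℂ → ℂ) (hm : Measurable h) (hb : ∃ M, ∀ z, ‖h z‖ ≤ M) :
    ∃ A : H →L[ℂ] H, ∀ x, ⟪x, A x⟫_ℂ = ∫ z, h z ∂(E.scalarMeasure x) := by
  obtain ⟨M, hM⟩ := hb
  let s : ℕ → SimpleFunc ℂ ℂ := SimpleFunc.approxOn h hm Set.univ 0 (Set.mem_univ 0)
  have hs : ∀ z, Filter.Tendsto (fun n => s n z) Filter.atTop (nhds (h z)) := fun z =>
    SimpleFunc.tendsto_approxOn hm (Set.mem_univ 0) (by simp)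
  have hsb : ∀ n z, ‖s n z‖ ≤ M + M := fun n z =>
    (SimpleFunc.norm_approxOn_zero_le hm (Set.mem_univ 0) z n).trans (by gcongr <;> exact hM z)
  let A : ℕ → H →L[ℂ] H := fun n => ∑ c ∈ (s n).range, c • E (s n ⁻¹' {c})
  have hA : ∀ n x, ⟪x, A n x⟫_ℂ = ∫ z, s n z ∂(E.scalarMeasure x) := fun n x => by
    rw [← SimpleFunc.integral_eq_integral _ (SimpleFunc.integrable_of_isFiniteMeasure _),
      SimpleFunc.integral_eq]
    simp only [A, sum_apply, inner_sum, smul_apply,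
      inner_smul_right]
    refine Finset.sum_congr rfl fun c _ => ?_
    rw [E.inner_proj x ((s n).measurableSet_fiber c), Measure.real,
      E.scalarMeasure_apply x ((s n).measurableSet_fiber c), ENNReal.toReal_ofReal (sq_nonneg _),
      Complex.real_smul, mul_comm]
    push_cast
    rfl
  have hlim : ∀ x, Filter.Tendsto (fun n => ⟪x, A n x⟫_ℂ) Filter.atTop
      (nhds (∫ z, h z ∂(E.scalarMeasure x))) := fun x => by
    simp only [hA]
    exact tendsto_integral_of_dominated_convergence (fun _ => M + M)
      (fun n => (s n).aestronglyMeasurable) (integrable_const _)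
      (fun n => Filter.Eventually.of_forall (hsb n)) (Filter.Eventually.of_forall hs)
  obtain ⟨B, hB⟩ := exists_tendsto_weakly A _ hlim
  exact ⟨B, fun x => tendsto_nhds_unique (hB x x) (hlim x)⟩

open Classical in
/-- The operator `∫ h dE` for a bounded and measurable function `h`, i.e. the bounded operator with
`((∫ h dE) x, x) = ∫ h(z) d(E(z) x, x)` for all `x` (and `0` for all other functions `h`). -/
def integral (h : ℂ → ℂ) : H →L[ℂ] H :=
  if hh : Measurable h ∧ ∃ M, ∀ z, ‖h z‖ ≤ M then (E.exists_integral h hh.1 hh.2).choose else 0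

theorem inner_integral {h : ℂ → ℂ} (hm : Measurable h) (hb : ∃ M, ∀ z, ‖h z‖ ≤ M) (x : H) :
    ⟪x, E.integral h x⟫_ℂ = ∫ z, h z ∂(E.scalarMeasure x) := by
  rw [integral, dif_pos ⟨hm, hb⟩]
  exact (E.exists_integral h hm hb).choose_spec x

/-- The operator `∫_S h dE`; only the values of `h` on `S` matter. -/
def integralOn (S : Set ℂ) (h : ℂ → ℂ) : H →L[ℂ] H :=
  E.integral (S.indicator h)

/-- `E` is the spectral measure of the operator `A`: it is concentrated on the spectrum of `A`,
and `A = ∫_{σ(A)} z dE(z)`. -/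
def IsSpectralMeasureOf (A : H →L[ℂ] H) : Prop :=
  E (spectrum ℂ A)ᶜ = 0 ∧ E.integralOn (spectrum ℂ A) (fun z => z) = A

end SpectralMeasure

section SpectralTheorem

variable {H : Type*} [NormedAddCommGroup H] [InnerProductSpace ℂ H] [CompleteSpace H]

theorem exists_measure_of_starAlgHom {X : Type*} [TopologicalSpace X] [CompactSpace X] [T2Space X]
    [MeasurableSpace X] [BorelSpace X] (φ : C(X, ℂ) →⋆ₐ[ℂ] (H →L[ℂ] H)) (x : H) :
    ∃ μ : Measure X, IsFiniteMeasure μ ∧ ∀ f : C(X, ℂ), ∫ z, f z ∂μ = ⟪x, φ f x⟫_ℂ := by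
  let ι : C(X, ℝ) → C(X, ℂ) := fun f => ⟨fun z => (f z : ℂ), by fun_prop⟩
  have hreal : ∀ f : C(X, ℝ), ((⟪x, φ (ι f) x⟫_ℂ).re : ℂ) = ⟪x, φ (ι f) x⟫_ℂ := fun f => by
    have h1 : star (ι f) = ι f := by ext z; simp [ι]
    have h2 : ContinuousLinearMap.adjoint (φ (ι f)) = φ (ι f) := by
      rw [← ContinuousLinearMap.star_eq_adjoint, ← map_star, h1]
    rw [← Complex.conj_eq_iff_re, inner_conj_symm]
    conv_lhs => rw [← h2]
    rw [ContinuousLinearMap.adjoint_inner_left]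
  let Λ : CompactlySupportedContinuousMap X ℝ →ₚ[ℝ] ℝ := PositiveLinearMap.mk₀
    { toFun := fun f => (⟪x, φ (ι f.toContinuousMap) x⟫_ℂ).re
      map_add' := fun f g => by
        have : ι (f + g).toContinuousMap = ι f.toContinuousMap + ι g.toContinuousMap := by
          ext z; simp [ι]
        rw [this, map_add, add_apply, inner_add_right, Complex.add_re]
      map_smul' := fun c f => by
        have : ι (c • f).toContinuousMap = (c : ℂ) • ι f.toContinuousMap := by
          ext z; simp [ι]
        rw [this, map_smul, smul_apply, inner_smul_right, Complex.re_ofReal_mul]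
        rfl }
    fun f hf => by
      let g : C(X, ℝ) := ⟨fun z => √(f z), by fun_prop⟩
      have h1 : ι f.toContinuousMap = star (ι g) * ι g := by
        ext z
        have : √(f z) * √(f z) = f z := Real.mul_self_sqrt (hf z)
        simp only [ι, g, ContinuousMap.mul_apply, ContinuousMap.star_apply, ContinuousMap.coe_mk,
          Complex.star_def, Complex.conj_ofReal, ← Complex.ofReal_mul, this]
        rfl
      change 0 ≤ (⟪x, φ (ι f.toContinuousMap) x⟫_ℂ).re
      rw [h1, map_mul, map_star, mul_apply_eq_comp, ContinuousLinearMap.star_eq_adjoint,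
        ContinuousLinearMap.adjoint_inner_right]
      exact inner_self_nonneg (𝕜 := ℂ)
  have hΛ : ∀ f : C(X, ℝ), ∫ z, f z ∂(RealRMK.rieszMeasure Λ) = (⟪x, φ (ι f) x⟫_ℂ).re :=
    fun f => RealRMK.integral_rieszMeasure Λ
      ⟨f, HasCompactSupport.of_compactSpace _⟩
  refine ⟨RealRMK.rieszMeasure Λ, inferInstance, fun f => ?_⟩
  let f₁ : C(X, ℝ) := ⟨fun z => (f z).re, by fun_prop⟩
  let f₂ : C(X, ℝ) := ⟨fun z => (f z).im, by fun_prop⟩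
  have hf : f = ι f₁ + Complex.I • ι f₂ := by
    ext z
    simp [ι, f₁, f₂, mul_comm Complex.I]
  have hint : Integrable f (RealRMK.rieszMeasure Λ) :=
    f.continuous.integrable_of_hasCompactSupport (HasCompactSupport.of_compactSpace _)
  rw [← integral_re_add_im hint]
  have e1 : ⟪x, φ (ι f₁) x⟫_ℂ = ((∫ z, f₁ z ∂(RealRMK.rieszMeasure Λ) : ℝ) : ℂ) := by
    rw [hΛ, hreal]
  have e2 : ⟪x, φ (ι f₂) x⟫_ℂ = ((∫ z, f₂ z ∂(RealRMK.rieszMeasure Λ) : ℝ) : ℂ) := by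
    rw [hΛ, hreal]
  conv_rhs => rw [hf, map_add, map_smul, add_apply, smul_apply, inner_add_right, inner_smul_right,
    e1, e2, mul_comm]
  rfl

theorem isSelfAdjoint_of_quadratic_real {A : H →L[ℂ] H} (h : ∀ x, ∃ r : ℝ, ⟪x, A x⟫_ℂ = r) :
    IsSelfAdjoint A := by
  rw [ContinuousLinearMap.isSelfAdjoint_iff']
  refine ext_quadratic fun x => ?_
  obtain ⟨r, hr⟩ := h x
  rw [ContinuousLinearMap.adjoint_inner_right, ← inner_conj_symm, hr, Complex.conj_ofReal]

theorem inner_eq_norm_sq_of_idempotent {P : H →L[ℂ] H} (hP : IsSelfAdjoint P) (hPP : P * P = P)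
    (x : H) : ⟪x, P x⟫_ℂ = ((‖P x‖ ^ 2 : ℝ) : ℂ) := by
  have h1 : P (P x) = P x := congrArg (fun D : H →L[ℂ] H => D x) hPP
  have h2 := ContinuousLinearMap.adjoint_inner_left P (P x) x
  rw [ContinuousLinearMap.isSelfAdjoint_iff'.mp hP, h1] at h2
  rw [← h2, inner_self_eq_norm_sq_to_K]
  push_cast
  rfl

theorem mul_eq_zero_of_quadratic_le {H : Type*} [NormedAddCommGroup H] [InnerProductSpace ℂ H]
    {P Q : H →L[ℂ] H} (hPP : P * P = P)
    (h : ∀ x, ‖P x‖ ^ 2 + ‖Q x‖ ^ 2 ≤ ‖x‖ ^ 2) : Q * P = 0 := by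
  ext x
  have h1 : P (P x) = P x := congrArg (fun D : H →L[ℂ] H => D x) hPP
  have h2 := h (P x)
  rw [h1] at h2
  have h3 : ‖Q (P x)‖ ^ 2 ≤ 0 := by linarith
  have h4 : ‖Q (P x)‖ = 0 := by nlinarith [norm_nonneg (Q (P x))]
  simpa using h4

theorem hasSum_measureReal {X : Type*} [MeasurableSpace X] (μ : Measure X) [IsFiniteMeasure μ]
    {Δ : ℕ → Set X} (hd : Pairwise (Function.onFun Disjoint Δ)) (hΔ : ∀ i, MeasurableSet (Δ i)) :
    HasSum (fun i => μ.real (Δ i)) (μ.real (⋃ i, Δ i)) := by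
  have h1 : ∑' i, μ (Δ i) = μ (⋃ i, Δ i) := (measure_iUnion hd hΔ).symm
  have h2 : ∑' i, μ (Δ i) ≠ ⊤ := h1 ▸ measure_ne_top μ _
  have h3 := ENNReal.hasSum_toReal h2
  rwa [← ENNReal.tsum_toReal_eq (fun i => measure_ne_top μ _), h1] at h3

/-- The bounded Borel functions `1_Δ` can be inserted in a continuous functional calculus. -/
theorem exists_proj_of_starAlgHom {X : Type*} [TopologicalSpace X] [CompactSpace X] [T2Space X]
    [MeasurableSpace X] [BorelSpace X] [HasOuterApproxClosed X]
    (φ : C(X, ℂ) →⋆ₐ[ℂ] (H →L[ℂ] H)) (μ : H → Measure X) [∀ x, IsFiniteMeasure (μ x)]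
    (hμ : ∀ x (f : C(X, ℂ)), ∫ z, f z ∂(μ x) = ⟪x, φ f x⟫_ℂ) (Δ : Set X) (hΔ : MeasurableSet Δ) :
    ∃ P : H →L[ℂ] H, P * P = P ∧ ∀ x, ⟪x, P x⟫_ℂ = ((μ x).real Δ : ℂ) := by
  have huniv : ∀ x, (μ x).real Set.univ = ‖x‖ ^ 2 := fun x => by
    have h1 := hμ x 1
    have h2 := inner_self_eq_norm_sq_to_K (𝕜 := ℂ) x
    simp only [ContinuousMap.one_apply, integral_const, map_one, one_apply_eq_self, h2,
      Complex.real_smul, mul_one] at h1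
    apply Complex.ofReal_injective
    rw [Complex.ofReal_pow]
    exact h1
  have hsa : ∀ {P : H →L[ℂ] H} {Δ : Set X}, (∀ x, ⟪x, P x⟫_ℂ = ((μ x).real Δ : ℂ)) →
      IsSelfAdjoint P := fun h => isSelfAdjoint_of_quadratic_real fun x => ⟨_, h x⟩
  refine MeasurableSpace.induction_on_inter (C := fun Δ _ => ∃ P : H →L[ℂ] H, P * P = P ∧
      ∀ x, ⟪x, P x⟫_ℂ = ((μ x).real Δ : ℂ))
    (BorelSpace.measurable_eq.trans borel_eq_generateFrom_isClosed) isPiSystem_isClosed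
    ?_ ?_ ?_ ?_ Δ hΔ
  · exact ⟨0, by simp, fun x => by simp⟩
  · intro F hF
    have hF' : IsClosed F := by simpa using hF
    let g : ℕ → C(X, ℂ) := fun n => ⟨fun z => ((hF'.apprSeq n z : ℝ) : ℂ), by fun_prop⟩
    have hg1 : ∀ n z, ‖g n z‖ ≤ 1 := fun n z => by
      have := HasOuterApproxClosed.apprSeq_apply_le_one hF' n z
      simpa [g] using this
    have hgF : ∀ n z, z ∈ F → g n z = 1 := fun n z hz => by
      simp [g, HasOuterApproxClosed.apprSeq_apply_eq_one hF' n hz]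
    have hglim : ∀ z, Filter.Tendsto (fun n => g n z) Filter.atTop
        (nhds (F.indicator (fun _ => (1 : ℂ)) z)) := fun z => by
      have h1 := (tendsto_pi_nhds.mp (HasOuterApproxClosed.tendsto_apprSeq hF')) z
      have h2 : Continuous (fun r : NNReal => ((r : ℝ) : ℂ)) := by fun_prop
      have h3 := (h2.tendsto _).comp h1
      have e : (((F.indicator (fun _ => (1 : NNReal)) z : NNReal) : ℝ) : ℂ)
          = F.indicator (fun _ => (1 : ℂ)) z := by
        by_cases hz : z ∈ F <;> simp [hz]
      rw [← e]
      exact h3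
    have hlim : ∀ x, Filter.Tendsto (fun n => ⟪x, φ (g n) x⟫_ℂ) Filter.atTop
        (nhds ((μ x).real F : ℂ)) := fun x => by
      simp only [← hμ]
      have e : ((μ x).real F : ℂ) = ∫ z, F.indicator (fun _ => (1 : ℂ)) z ∂(μ x) := by
        rw [integral_indicator hF'.measurableSet]
        simp
      rw [e]
      exact tendsto_integral_of_dominated_convergence (fun _ => 1)
        (fun n => (g n).continuous.aestronglyMeasurable) (integrable_const _)
        (fun n => Filter.Eventually.of_forall (hg1 n)) (Filter.Eventually.of_forall hglim)
    have hlim2 : ∀ m x, Filter.Tendsto (fun n => ⟪x, φ (g n) (φ (g m) x)⟫_ℂ) Filter.atTop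
        (nhds ((μ x).real F : ℂ)) := fun m x => by
      have e0 : ∀ n, ⟪x, φ (g n) (φ (g m) x)⟫_ℂ = ∫ z, (g n * g m) z ∂(μ x) := fun n => by
        rw [hμ, map_mul]
        rfl
      simp only [e0]
      have e : ((μ x).real F : ℂ) = ∫ z, F.indicator (fun _ => (1 : ℂ)) z ∂(μ x) := by
        rw [integral_indicator hF'.measurableSet]
        simp
      rw [e]
      refine tendsto_integral_of_dominated_convergence (fun _ => 1)
        (fun n => (g n * g m).continuous.aestronglyMeasurable) (integrable_const _)
        (fun n => Filter.Eventually.of_forall fun z => ?_)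
        (Filter.Eventually.of_forall fun z => ?_)
      · rw [ContinuousMap.mul_apply, norm_mul]
        exact mul_le_one₀ (hg1 n z) (norm_nonneg _) (hg1 m z)
      · have := (hglim z).mul_const (g m z)
        by_cases hz : z ∈ F
        · simpa [hz, hgF] using this
        · simp [hz] at this ⊢
          exact this
    obtain ⟨P, hP⟩ := exists_tendsto_weakly (fun n => φ (g n)) _ hlim
    have hq : ∀ x, ⟪x, P x⟫_ℂ = ((μ x).real F : ℂ) := fun x =>
      tendsto_nhds_unique (hP x x) (hlim x)
    have hPg : ∀ m, P * φ (g m) = P := fun m => ext_quadratic fun x => by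
      rw [mul_apply_eq_comp, hq]
      exact tendsto_nhds_unique (hP x (φ (g m) x)) (hlim2 m x)
    refine ⟨P, ext_quadratic fun x => ?_, hq⟩
    have h1 := hP (ContinuousLinearMap.adjoint P x) x
    simp only [ContinuousLinearMap.adjoint_inner_left, ← mul_apply_eq_comp, hPg] at h1
    exact (tendsto_nhds_unique h1 tendsto_const_nhds)
  · intro Δ hΔ ih
    obtain ⟨P, hPP, hP⟩ := ih
    refine ⟨1 - P, by simp [sub_mul, mul_sub, hPP], fun x => ?_⟩
    rw [measureReal_compl hΔ, sub_apply, one_apply_eq_self, inner_sub_right, hP, huniv,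
      inner_self_eq_norm_sq_to_K]
    push_cast
    rfl
  · intro Δ hd hΔ ih
    choose P hPP hP using ih
    have hnorm : ∀ i x, ‖P i x‖ ^ 2 = (μ x).real (Δ i) := fun i x => by
      have := inner_eq_norm_sq_of_idempotent (hsa (hP i)) (hPP i) x
      rw [hP] at this
      exact_mod_cast this.symm
    have horth : ∀ i j, i ≠ j → P i * P j = 0 := fun i j hij =>
      mul_eq_zero_of_quadratic_le (hPP j) fun x => by
        rw [hnorm, hnorm, ← huniv, ← measureReal_union (hd hij.symm) (hΔ i)]
        exact measureReal_mono (Set.subset_univ _)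
    have hlim : ∀ x, Filter.Tendsto (fun n => ⟪x, (∑ i ∈ Finset.range n, P i) x⟫_ℂ) Filter.atTop
        (nhds ((μ x).real (⋃ i, Δ i) : ℂ)) := fun x => by
      have h1 : HasSum (fun i => (μ x).real (Δ i)) ((μ x).real (⋃ i, Δ i)) :=
        hasSum_measureReal _ hd hΔ
      have h2 := (Complex.hasSum_ofReal.mpr h1).tendsto_sum_nat
      simpa only [sum_apply, inner_sum, hP] using h2
    obtain ⟨Q, hQ⟩ := exists_tendsto_weakly (fun n => ∑ i ∈ Finset.range n, P i) _ hlim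
    have hPQ : ∀ i, P i * Q = P i := fun i => ext_quadratic fun x => by
      have h1 := hQ (ContinuousLinearMap.adjoint (P i) x) x
      simp only [ContinuousLinearMap.adjoint_inner_left] at h1
      refine tendsto_nhds_unique h1 (tendsto_const_nhds.congr' ?_)
      filter_upwards [Filter.eventually_gt_atTop i] with n hn
      rw [← mul_apply_eq_comp, Finset.mul_sum, Finset.sum_eq_single i
        (fun j _ hj => horth i j hj.symm) (fun h => absurd (Finset.mem_range.mpr hn) h), hPP]
    refine ⟨Q, ext_quadratic fun x => ?_, fun x => tendsto_nhds_unique (hQ x x) (hlim x)⟩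
    have h1 := hQ x (Q x)
    simp only [← mul_apply_eq_comp, Finset.sum_mul, hPQ] at h1
    exact tendsto_nhds_unique h1 (hQ x x)

/-- The spectral theorem for bounded normal operators. -/
theorem exists_isSpectralMeasureOf (A : H →L[ℂ] H) (hA : IsStarNormal A) :
    ∃ E : SpectralMeasure H, E.IsSpectralMeasureOf A := by
  let X := spectrum ℂ A
  have : CompactSpace X := isCompact_iff_compactSpace.mp (spectrum.isCompact A)
  let φ : C(X, ℂ) →⋆ₐ[ℂ] (H →L[ℂ] H) := cfcHom hA
  choose μ hfin hμ using exists_measure_of_starAlgHom φ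
  choose P hPP hP using fun (Δ : Set X) (hΔ : MeasurableSet Δ) =>
    exists_proj_of_starAlgHom φ μ hμ Δ hΔ
  have hsa : ∀ Δ hΔ, IsSelfAdjoint (P Δ hΔ) := fun Δ hΔ =>
    isSelfAdjoint_of_quadratic_real fun x => ⟨_, hP Δ hΔ x⟩
  have hnorm : ∀ Δ hΔ x, ‖P Δ hΔ x‖ ^ 2 = (μ x).real Δ := fun Δ hΔ x => by
    have := inner_eq_norm_sq_of_idempotent (hsa Δ hΔ) (hPP Δ hΔ) x
    rw [hP] at this
    exact_mod_cast this.symm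
  have huniv : P Set.univ .univ = 1 := ext_quadratic fun x => by
    have h1 := hμ x 1
    simp only [ContinuousMap.one_apply, integral_const, map_one, one_apply_eq_self,
      Complex.real_smul, mul_one] at h1
    rw [hP, h1, one_apply_eq_self]
  have hadd : ∀ Δ₁ h₁ Δ₂ h₂, Disjoint Δ₁ Δ₂ →
      P (Δ₁ ∪ Δ₂) (MeasurableSet.union h₁ h₂) = P Δ₁ h₁ + P Δ₂ h₂ := fun Δ₁ h₁ Δ₂ h₂ hd =>
    ext_quadratic fun x => by
      rw [hP, add_apply, inner_add_right, hP, hP, measureReal_union hd h₂]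
      push_cast
      rfl
  have horth : ∀ Δ₁ h₁ Δ₂ h₂, Disjoint Δ₁ Δ₂ → P Δ₁ h₁ * P Δ₂ h₂ = 0 := fun Δ₁ h₁ Δ₂ h₂ hd =>
    mul_eq_zero_of_quadratic_le (hPP Δ₂ h₂) fun x => by
      have e : ‖x‖ ^ 2 = (μ x).real Set.univ := by
        rw [← hnorm Set.univ .univ x, huniv, one_apply_eq_self]
      rw [hnorm, hnorm, e, ← measureReal_union hd.symm h₁]
      exact measureReal_mono (Set.subset_univ _)
  have hinter : ∀ Δ₁ h₁ Δ₂ h₂, P (Δ₁ ∩ Δ₂) (MeasurableSet.inter h₁ h₂) = P Δ₁ h₁ * P Δ₂ h₂ :=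
    fun Δ₁ h₁ Δ₂ h₂ => by
      have e₁ : P Δ₁ h₁ = P (Δ₁ ∩ Δ₂) (h₁.inter h₂) + P (Δ₁ \ Δ₂) (h₁.diff h₂) := by
        rw [← hadd _ _ _ _ Set.disjoint_sdiff_inter.symm]
        congr 1
        exact (Set.inter_union_sdiff Δ₁ Δ₂).symm
      have e₂ : P Δ₂ h₂ = P (Δ₁ ∩ Δ₂) (h₁.inter h₂) + P (Δ₂ \ Δ₁) (h₂.diff h₁) := by
        rw [← hadd _ _ _ _ (by rw [Set.inter_comm]; exact Set.disjoint_sdiff_inter.symm)]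
        congr 1
        rw [Set.inter_comm]
        exact (Set.inter_union_sdiff Δ₂ Δ₁).symm
      rw [e₁, e₂, mul_add, add_mul, add_mul, hPP, horth _ _ (Δ₁ ∩ Δ₂), horth (Δ₁ ∩ Δ₂),
        horth (Δ₁ \ Δ₂)]
      · simp
      · exact disjoint_sdiff_sdiff
      · exact Set.disjoint_left.mpr fun z hz hz' => hz'.2 hz.1
      · exact Set.disjoint_left.mpr fun z hz hz' => hz.2 hz'.2
  have hval : Measurable (Subtype.val : X → ℂ) := measurable_subtype_coe
  classical
  let E : SpectralMeasure H :=
    { proj := fun Δ => if hΔ : MeasurableSet Δ then P (Subtype.val ⁻¹' Δ) (hval hΔ) else 0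
      isStarProjection := fun Δ hΔ => by
        rw [dif_pos hΔ]
        exact ⟨hPP _ _, hsa _ _⟩
      proj_univ := by
        rw [dif_pos .univ]
        exact huniv
      proj_inter := fun Δ₁ Δ₂ h₁ h₂ => by
        rw [dif_pos h₁, dif_pos h₂, dif_pos (h₁.inter h₂)]
        exact hinter _ _ _ _
      proj_iUnion := fun Δ hΔ hd x => by
        have e : ∀ n, (if hΔ : MeasurableSet (Δ n) then P (Subtype.val ⁻¹' Δ n) (hval hΔ) else 0)
            = P (Subtype.val ⁻¹' Δ n) (hval (hΔ n)) := fun n => dif_pos (hΔ n)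
        have hU : MeasurableSet (⋃ n, Δ n) := .iUnion hΔ
        simp only [e]
        rw [dif_pos hU]
        have hd' : Pairwise (Function.onFun Disjoint fun n => (Subtype.val ⁻¹' Δ n : Set X)) :=
          fun i j hij => (hd hij).preimage _
        have hs : HasSum (fun n => (μ x).real (Subtype.val ⁻¹' Δ n))
            ((μ x).real (Subtype.val ⁻¹' ⋃ n, Δ n)) := by
          rw [Set.preimage_iUnion]
          exact hasSum_measureReal _ hd' fun i => hval (hΔ i)
        have hsq : ∀ s : Finset ℕ, ‖(∑ n ∈ s, P (Subtype.val ⁻¹' Δ n) (hval (hΔ n)) x)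
            - P (Subtype.val ⁻¹' ⋃ n, Δ n) (hval hU) x‖ ^ 2
            = (μ x).real (Subtype.val ⁻¹' ⋃ n, Δ n)
              - ∑ n ∈ s, (μ x).real (Subtype.val ⁻¹' Δ n) := fun s => by
          have hD : MeasurableSet (⋃ n ∈ s, (Subtype.val ⁻¹' Δ n : Set X)) :=
            Finset.measurableSet_biUnion s fun n _ => hval (hΔ n)
          have hDU : (⋃ n ∈ s, (Subtype.val ⁻¹' Δ n : Set X)) ⊆ Subtype.val ⁻¹' ⋃ n, Δ n := by
            rw [Set.preimage_iUnion]
            exact Set.iUnion₂_subset_iUnion _ _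
          have hm : (μ x).real (⋃ n ∈ s, (Subtype.val ⁻¹' Δ n : Set X))
              = ∑ n ∈ s, (μ x).real (Subtype.val ⁻¹' Δ n) :=
            measureReal_biUnion_finset (fun i _ j _ hij => hd' hij) fun n _ => hval (hΔ n)
          have e₁ : ∑ n ∈ s, P (Subtype.val ⁻¹' Δ n) (hval (hΔ n)) = P _ hD :=
            ext_quadratic fun y => by
              rw [hP, sum_apply, inner_sum, measureReal_biUnion_finset
                (fun i _ j _ hij => hd' hij) fun n _ => hval (hΔ n)]
              simp only [hP]
              push_cast
              rfl
          have e₂ : P (Subtype.val ⁻¹' ⋃ n, Δ n) (hval hU)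
              = P _ hD + P _ ((hval hU).diff hD) := by
            rw [← hadd _ _ _ _ Set.disjoint_sdiff_right]
            congr 1
            exact (Set.union_sdiff_cancel hDU).symm
          rw [← sum_apply, e₁, e₂, add_apply, sub_add_cancel_left, norm_neg, hnorm, ← hm,
            measureReal_sdiff hDU hD]
        rw [HasSum, tendsto_iff_norm_sub_tendsto_zero]
        have h0 : Filter.Tendsto (fun s : Finset ℕ =>
            ‖(∑ n ∈ s, P (Subtype.val ⁻¹' Δ n) (hval (hΔ n)) x)
              - P (Subtype.val ⁻¹' ⋃ n, Δ n) (hval hU) x‖ ^ 2)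
            (SummationFilter.unconditional ℕ).filter (nhds 0) := by
          simp only [hsq]
          simpa using (tendsto_const_nhds (x := (μ x).real (Subtype.val ⁻¹' ⋃ n, Δ n))).sub hs
        have h1 := (Real.continuous_sqrt.tendsto _).comp h0
        simpa [Function.comp_def, Real.sqrt_sq] using h1 }
  have hE : ∀ Δ, (hΔ : MeasurableSet Δ) → E Δ = P (Subtype.val ⁻¹' Δ) (hval hΔ) := fun Δ hΔ =>
    dif_pos hΔ
  have hσ : MeasurableSet (spectrum ℂ A) := (spectrum.isClosed A).measurableSet
  have hscalar : ∀ x, E.scalarMeasure x = (μ x).map Subtype.val := fun x => by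
    ext Δ hΔ
    rw [E.scalarMeasure_apply x hΔ, hE Δ hΔ, hnorm, Measure.map_apply hval hΔ, Measure.real,
      ENNReal.ofReal_toReal (measure_ne_top _ _)]
  refine ⟨E, ?_, ext_quadratic fun x => ?_⟩
  · rw [hE _ hσ.compl]
    refine ext_quadratic fun x => ?_
    rw [hP]
    have : (Subtype.val ⁻¹' (spectrum ℂ A)ᶜ : Set X) = ∅ := by
      ext z
      simpa using z.2
    simp [this]
  · have hmeas : Measurable ((spectrum ℂ A).indicator fun z : ℂ => z) :=
      measurable_id.indicator hσ
    rw [SpectralMeasure.integralOn, E.inner_integral hmeas, hscalar,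
      integral_map hval.aemeasurable hmeas.aestronglyMeasurable]
    · have h1 := hμ x ((ContinuousMap.id ℂ).restrict (spectrum ℂ A))
      have h2 : φ ((ContinuousMap.id ℂ).restrict (spectrum ℂ A)) = A := cfcHom_id hA
      rw [h2] at h1
      rw [← h1]
      refine integral_congr_ae (Filter.Eventually.of_forall fun z => ?_)
      exact Set.indicator_of_mem z.2 _
    · refine ⟨‖A‖ * ‖(1 : H →L[ℂ] H)‖, fun z => ?_⟩
      by_cases hz : z ∈ spectrum ℂ A
      · rw [Set.indicator_of_mem hz]
        exact spectrum.norm_le_norm_mul_of_mem hz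
      · rw [Set.indicator_of_notMem hz, norm_zero]
        positivity

/-- The spectral measure of a normal operator. -/
def spectralMeasure (A : H →L[ℂ] H) (hA : IsStarNormal A) : SpectralMeasure H :=
  (exists_isSpectralMeasureOf A hA).choose

theorem isSpectralMeasureOf_spectralMeasure (A : H →L[ℂ] H) (hA : IsStarNormal A) :
    (spectralMeasure A hA).IsSpectralMeasureOf A :=
  (exists_isSpectralMeasureOf A hA).choose_spec

end SpectralTheorem
end

/-! Write `A` and `B` for the operators that `N` induces on `H` and `Hs j`, so that `T A = N T` and
`T_j B = N T_j`. Cancelling the injective `T` in `T R_j B = N T_j = T A R_j` gives `R_j B = A R_j`.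
Because `N` commutes with `T T⁺`, also `T A* = N⁺ T`: both sides agree on the range of `T⁺`, which
is dense since `T` is injective. The same holds for `T_j` and `B`. Normality of `N` therefore passes
to `A` and `B`, and `R_j B* = A* R_j` follows by the same cancellation.

So `R_j` intertwines two normal operators together with their adjoints, and the heart of the matter
is that it then intertwines their spectral measures (`comp_proj_eq_proj_comp`). Since `R_j` is
injective, `R_j E_j(Δ) = E(Δ) R_j` is the identity for `Γ_j`. Applying the same result to a
self-adjoint `D` that commutes with `A` or `B` yields all the commutant memberships.

The intertwining rests on a norm comparison. On the range of a spectral projection of a closed ball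
of radius `r` about `a`, the operator `B - a` has norm at most `r`. On the range of the projection
of the complement of an open ball of radius `R > r`, the operator `A - a` is bounded below by `R`.
An intertwiner compressed between these two ranges has norm at most `r / R` times its own norm,
hence vanishes. Both estimates come from `‖(∫ h dE) x‖² = ∫ |h|² d(E x, x)`, that is, from
multiplicativity of the integral. Balls generate the Borel sets, and simple functions lead from
projections to integrals. -/

namespace SpectralMeasure

/-! ### Bounded functional calculus of a spectral measure. -/

variable {H : Type*} [NormedAddCommGroup H] [InnerProductSpace ℂ H] [CompleteSpace H]

theorem inner_proj_left (E : SpectralMeasure H) {Δ : Set ℂ} (hΔ : MeasurableSet Δ) (x y : H) :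
    ⟪E Δ x, y⟫_ℂ = ⟪x, E Δ y⟫_ℂ := by
  have h := ContinuousLinearMap.adjoint_inner_left (E Δ) y x
  rwa [← ContinuousLinearMap.star_eq_adjoint,
    (E.isStarProjection Δ hΔ).isSelfAdjoint.star_eq] at h

theorem inner_proj_eq_measureReal (E : SpectralMeasure H) {Δ : Set ℂ} (hΔ : MeasurableSet Δ)
    (x : H) : ⟪x, E Δ x⟫_ℂ = ((E.scalarMeasure x).real Δ : ℂ) := by
  rw [E.inner_proj x hΔ, Measure.real, E.scalarMeasure_apply x hΔ,
    ENNReal.toReal_ofReal (sq_nonneg _)]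
  push_cast
  rfl

theorem scalarMeasure_real_univ (E : SpectralMeasure H) (x : H) :
    (E.scalarMeasure x).real Set.univ = ‖x‖ ^ 2 := by
  rw [Measure.real, E.scalarMeasure_apply x .univ, ENNReal.toReal_ofReal (sq_nonneg _),
    E.proj_univ, one_apply_eq_self]

theorem proj_compl (E : SpectralMeasure H) {Δ : Set ℂ} (hΔ : MeasurableSet Δ) :
    E Δᶜ = 1 - E Δ := ext_quadratic fun x => by
  rw [sub_apply, inner_sub_right, E.inner_proj_eq_measureReal hΔ.compl,
    E.inner_proj_eq_measureReal hΔ, measureReal_compl hΔ, E.scalarMeasure_real_univ,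
    one_apply_eq_self, inner_self_eq_norm_sq_to_K]
  push_cast
  rfl

theorem proj_mul_self (E : SpectralMeasure H) {Δ : Set ℂ} (hΔ : MeasurableSet Δ) :
    E Δ * E Δ = E Δ := (E.isStarProjection Δ hΔ).isIdempotentElem

theorem proj_mul_compl (E : SpectralMeasure H) {Δ : Set ℂ} (hΔ : MeasurableSet Δ) :
    E Δ * E Δᶜ = 0 := by
  rw [E.proj_compl hΔ, mul_sub, mul_one, E.proj_mul_self hΔ, sub_self]

theorem compl_mul_proj (E : SpectralMeasure H) {Δ : Set ℂ} (hΔ : MeasurableSet Δ) :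
    E Δᶜ * E Δ = 0 := by
  rw [E.proj_compl hΔ, sub_mul, one_mul, E.proj_mul_self hΔ, sub_self]

/-- Multiplicativity of `E` in terms of measures: projecting the vector restricts its measure.
Localisation to ranges of spectral projections rests on this. -/
theorem scalarMeasure_proj (E : SpectralMeasure H) {Δ : Set ℂ} (hΔ : MeasurableSet Δ) (x : H) :
    E.scalarMeasure (E Δ x) = (E.scalarMeasure x).restrict Δ := by
  ext S hS
  rw [Measure.restrict_apply hS, E.scalarMeasure_apply _ hS, E.scalarMeasure_apply _ (hS.inter hΔ),
    E.proj_inter S Δ hS hΔ]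
  rfl

theorem integrable_of_bounded {μ : Measure ℂ} [IsFiniteMeasure μ] {h : ℂ → ℂ} (hm : Measurable h)
    (hb : ∃ M, ∀ z, ‖h z‖ ≤ M) : Integrable h μ := by
  obtain ⟨M, hM⟩ := hb
  exact Integrable.of_bound hm.aestronglyMeasurable M (Filter.Eventually.of_forall hM)

theorem inner_proj_integral_proj (E : SpectralMeasure H) {h : ℂ → ℂ} (hm : Measurable h)
    (hb : ∃ M, ∀ z, ‖h z‖ ≤ M) {Δ : Set ℂ} (hΔ : MeasurableSet Δ) (x : H) :
    ⟪x, (E Δ * E.integral h * E Δ) x⟫_ℂ = ∫ z in Δ, h z ∂(E.scalarMeasure x) := by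
  rw [mul_apply_eq_comp, mul_apply_eq_comp, ← E.inner_proj_left hΔ, E.inner_integral hm hb,
    E.scalarMeasure_proj hΔ]

/-- Splitting the scalar integral over `Δ` and its complement shows that the integral is block
diagonal for `E Δ`. Commutation with `E Δ` follows by multiplying with the projection on either
side. -/
theorem integral_eq_add_compl (E : SpectralMeasure H) {h : ℂ → ℂ} (hm : Measurable h)
    (hb : ∃ M, ∀ z, ‖h z‖ ≤ M) {Δ : Set ℂ} (hΔ : MeasurableSet Δ) :
    E.integral h = E Δ * E.integral h * E Δ + E Δᶜ * E.integral h * E Δᶜ :=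
  ext_quadratic fun x => by
    rw [add_apply, inner_add_right, E.inner_proj_integral_proj hm hb hΔ,
      E.inner_proj_integral_proj hm hb hΔ.compl, integral_add_compl hΔ (integrable_of_bounded hm hb),
      E.inner_integral hm hb]

theorem proj_mul_integral (E : SpectralMeasure H) {h : ℂ → ℂ} (hm : Measurable h)
    (hb : ∃ M, ∀ z, ‖h z‖ ≤ M) {Δ : Set ℂ} (hΔ : MeasurableSet Δ) :
    E Δ * E.integral h = E Δ * E.integral h * E Δ := by
  conv_lhs => rw [E.integral_eq_add_compl hm hb hΔ]
  simp only [mul_add, ← mul_assoc, E.proj_mul_self hΔ, E.proj_mul_compl hΔ, zero_mul, add_zero]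

theorem integral_mul_proj (E : SpectralMeasure H) {h : ℂ → ℂ} (hm : Measurable h)
    (hb : ∃ M, ∀ z, ‖h z‖ ≤ M) {Δ : Set ℂ} (hΔ : MeasurableSet Δ) :
    E.integral h * E Δ = E Δ * E.integral h := by
  rw [E.proj_mul_integral hm hb hΔ]
  conv_lhs => rw [E.integral_eq_add_compl hm hb hΔ]
  simp only [add_mul, mul_assoc, E.proj_mul_self hΔ, E.compl_mul_proj hΔ, mul_zero, add_zero]

/-- Dominated convergence controls only quadratic forms; `exists_tendsto_weakly` supplies a weak
operator limit, which its quadratic form identifies. -/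
theorem tendsto_inner_integral (E : SpectralMeasure H) {f : ℕ → ℂ → ℂ} {h : ℂ → ℂ} {M : ℝ}
    (hf : ∀ n, Measurable (f n)) (hM : ∀ n z, ‖f n z‖ ≤ M)
    (hlim : ∀ z, Filter.Tendsto (fun n => f n z) Filter.atTop (nhds (h z))) (x y : H) :
    Filter.Tendsto (fun n => ⟪x, E.integral (f n) y⟫_ℂ) Filter.atTop
      (nhds ⟪x, E.integral h y⟫_ℂ) := by
  have hm : Measurable h := measurable_of_tendsto_metrizable hf (tendsto_pi_nhds.mpr hlim)
  have hb : ∀ z, ‖h z‖ ≤ M := fun z =>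
    le_of_tendsto (hlim z).norm (Filter.Eventually.of_forall fun n => hM n z)
  have hq : ∀ x, Filter.Tendsto (fun n => ⟪x, E.integral (f n) x⟫_ℂ) Filter.atTop
      (nhds ⟪x, E.integral h x⟫_ℂ) := fun x => by
    simp only [E.inner_integral (hf _) ⟨M, hM _⟩, E.inner_integral hm ⟨M, hb⟩]
    exact tendsto_integral_of_dominated_convergence (fun _ => M)
      (fun n => (hf n).aestronglyMeasurable) (integrable_const _)
      (fun n => Filter.Eventually.of_forall (hM n)) (Filter.Eventually.of_forall hlim)
  obtain ⟨B, hB⟩ := exists_tendsto_weakly _ _ hq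
  rw [ext_quadratic fun x => tendsto_nhds_unique (hq x) (hB x x)]
  exact hB x y

theorem exists_simpleFunc_tendsto {h : ℂ → ℂ} (hm : Measurable h) (hb : ∃ M, ∀ z, ‖h z‖ ≤ M) :
    ∃ (s : ℕ → SimpleFunc ℂ ℂ) (M : ℝ), (∀ n z, ‖s n z‖ ≤ M) ∧
      ∀ z, Filter.Tendsto (fun n => s n z) Filter.atTop (nhds (h z)) := by
  obtain ⟨M, hM⟩ := hb
  refine ⟨SimpleFunc.approxOn h hm Set.univ 0 (Set.mem_univ 0), M + M, fun n z => ?_, fun z => ?_⟩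
  · exact (SimpleFunc.norm_approxOn_zero_le hm (Set.mem_univ 0) z n).trans
      (by gcongr <;> exact hM z)
  · exact SimpleFunc.tendsto_approxOn hm (Set.mem_univ 0) (by simp)

theorem simpleFunc_bounded (s : SimpleFunc ℂ ℂ) : ∃ M, ∀ z, ‖s z‖ ≤ M :=
  s.exists_forall_norm_le

theorem integral_simpleFunc (E : SpectralMeasure H) (s : SimpleFunc ℂ ℂ) :
    E.integral s = ∑ c ∈ s.range, c • E (s ⁻¹' {c}) := ext_quadratic fun x => by
  rw [E.inner_integral s.measurable (simpleFunc_bounded s), ← SimpleFunc.integral_eq_integral _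
    (SimpleFunc.integrable_of_isFiniteMeasure _), SimpleFunc.integral_eq]
  simp only [sum_apply, inner_sum, smul_apply, inner_smul_right]
  refine Finset.sum_congr rfl fun c _ => ?_
  rw [E.inner_proj_eq_measureReal (s.measurableSet_fiber c), Complex.real_smul, mul_comm]

theorem integral_simpleFunc_mul (E : SpectralMeasure H) (s : SimpleFunc ℂ ℂ) {g : ℂ → ℂ}
    (hm : Measurable g) (hb : ∃ M, ∀ z, ‖g z‖ ≤ M) :
    E.integral (fun z => s z * g z) = E.integral s * E.integral g := ext_quadratic fun x => by
  obtain ⟨M, hM⟩ := hb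
  obtain ⟨M', hM'⟩ := simpleFunc_bounded s
  have hsg : ∀ z, s z * g z
      = ∑ c ∈ s.range, (s ⁻¹' {c}).indicator (fun z => c * g z) z := fun z => by
    rw [Finset.sum_eq_single (s z)]
    · simp
    · intro c _ hc
      exact Set.indicator_of_notMem (by simpa using hc.symm) _
    · intro h
      exact absurd (SimpleFunc.mem_range_self s z) h
  have hint : ∀ c : ℂ, Integrable (fun z => c * g z) (E.scalarMeasure x) := fun c =>
    (integrable_of_bounded hm ⟨M, hM⟩).const_mul c
  rw [E.inner_integral (h := fun z => s z * g z) (s.measurable.mul hm) ⟨M' * M, fun z => ?_⟩,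
    E.integral_simpleFunc]
  · simp only [hsg]
    rw [integral_finsetSum _ fun c _ => (hint c).indicator (s.measurableSet_fiber c)]
    simp only [Finset.sum_mul, sum_apply, inner_sum]
    refine Finset.sum_congr rfl fun c _ => ?_
    rw [integral_indicator (s.measurableSet_fiber c), integral_const_mul, smul_mul_assoc,
      smul_apply, inner_smul_right, E.proj_mul_integral hm ⟨M, hM⟩ (s.measurableSet_fiber c),
      E.inner_proj_integral_proj hm ⟨M, hM⟩ (s.measurableSet_fiber c)]
  · rw [norm_mul]
    exact mul_le_mul (hM' z) (hM z) (norm_nonneg _) ((norm_nonneg _).trans (hM' z))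

/-- Only `f` needs approximation by simple functions: for simple `f` and arbitrary `g` the identity
reduces to commutation of the integral of `g` with projections. -/
theorem integral_mul (E : SpectralMeasure H) {f g : ℂ → ℂ} (hf : Measurable f)
    (hfb : ∃ M, ∀ z, ‖f z‖ ≤ M) (hg : Measurable g) (hgb : ∃ M, ∀ z, ‖g z‖ ≤ M) :
    E.integral (fun z => f z * g z) = E.integral f * E.integral g := ext_quadratic fun x => by
  obtain ⟨s, M, hM, hs⟩ := exists_simpleFunc_tendsto hf hfb
  obtain ⟨M', hM'⟩ := hgb
  have h1 := E.tendsto_inner_integral (fun n => (s n).measurable) hM hs x (E.integral g x)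
  have h2 := E.tendsto_inner_integral (f := fun n z => s n z * g z) (M := M * M')
    (fun n => (s n).measurable.mul hg) (fun n z => by
      rw [norm_mul]
      exact mul_le_mul (hM n z) (hM' z) (norm_nonneg _) ((norm_nonneg _).trans (hM n z)))
    (fun z => (hs z).mul_const (g z)) x x
  simp only [E.integral_simpleFunc_mul _ hg ⟨M', hM'⟩, mul_apply_eq_comp] at h2
  exact tendsto_nhds_unique h2 h1

theorem adjoint_integral (E : SpectralMeasure H) {h : ℂ → ℂ} (hm : Measurable h)
    (hb : ∃ M, ∀ z, ‖h z‖ ≤ M) :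
    ContinuousLinearMap.adjoint (E.integral h) = E.integral (fun z => conj (h z)) :=
  ext_quadratic fun x => by
    rw [ContinuousLinearMap.adjoint_inner_right, ← inner_conj_symm, E.inner_integral hm hb,
      E.inner_integral (by fun_prop) (by simpa using hb), ← integral_conj]

theorem norm_integral_apply_sq (E : SpectralMeasure H) {h : ℂ → ℂ} (hm : Measurable h)
    (hb : ∃ M, ∀ z, ‖h z‖ ≤ M) (x : H) :
    ‖E.integral h x‖ ^ 2 = ∫ z, ‖h z‖ ^ 2 ∂(E.scalarMeasure x) := by
  obtain ⟨M, hM⟩ := hb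
  have h1 := inner_self_eq_norm_sq_to_K (𝕜 := ℂ) (E.integral h x)
  rw [← ContinuousLinearMap.adjoint_inner_right, E.adjoint_integral hm ⟨M, hM⟩,
    ← mul_apply_eq_comp, ← E.integral_mul (by fun_prop) ⟨M, by simpa using hM⟩ hm ⟨M, hM⟩,
    E.inner_integral (by fun_prop) ⟨M * M, fun z => ?_⟩] at h1
  · have h2 : ∀ z, conj (h z) * h z = ((‖h z‖ ^ 2 : ℝ) : ℂ) := fun z => by
      rw [mul_comm, Complex.mul_conj, Complex.normSq_eq_norm_sq]
    simp only [h2, integral_complex_ofReal] at h1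
    exact Complex.ofReal_injective ((Complex.ofReal_pow _ _).trans h1.symm)
  · rw [norm_mul, RCLike.norm_conj]
    exact mul_le_mul (hM z) (hM z) (norm_nonneg _) ((norm_nonneg _).trans (hM z))

theorem integral_congr_of_proj_compl_eq_zero (E : SpectralMeasure H) {f g : ℂ → ℂ}
    (hf : Measurable f) (hfb : ∃ M, ∀ z, ‖f z‖ ≤ M) (hg : Measurable g)
    (hgb : ∃ M, ∀ z, ‖g z‖ ≤ M) {S : Set ℂ} (hS : MeasurableSet S) (hE : E Sᶜ = 0)
    (h : ∀ z ∈ S, f z = g z) : E.integral f = E.integral g := ext_quadratic fun x => by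
  rw [E.inner_integral hf hfb, E.inner_integral hg hgb]
  refine integral_congr_ae ?_
  have h0 : E.scalarMeasure x Sᶜ = 0 := by
    rw [E.scalarMeasure_apply x hS.compl, hE]
    simp
  filter_upwards [compl_mem_ae_iff.mpr h0] with z hz
  exact h z (not_not.mp hz)

theorem norm_indicator_le {σ : Set ℂ} {h : ℂ → ℂ} {M : ℝ} (hM : ∀ z ∈ σ, ‖h z‖ ≤ M) :
    ∃ M, ∀ z, ‖σ.indicator h z‖ ≤ M := by
  -- The maximum with `0` covers the points off `σ`, in particular an empty `σ` with negative `M`.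
  refine ⟨max M 0, fun z => ?_⟩
  by_cases hz : z ∈ σ
  · rw [Set.indicator_of_mem hz]
    exact (hM z hz).trans (le_max_left _ _)
  · rw [Set.indicator_of_notMem hz, norm_zero]
    exact le_max_right _ _

theorem ae_mem_of_proj_compl_eq_zero (E : SpectralMeasure H) {S : Set ℂ} (hS : MeasurableSet S)
    {x : H} (hE : E Sᶜ x = 0) : ∀ᵐ z ∂(E.scalarMeasure x), z ∈ S := by
  rw [ae_iff]
  change E.scalarMeasure x Sᶜ = 0
  rw [E.scalarMeasure_apply x hS.compl, hE]
  simp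

/-! ### Norm estimates for `A - a` from the spectral measure of `A`. -/

namespace IsSpectralMeasureOf

variable {E : SpectralMeasure H} {A : H →L[ℂ] H}

theorem exists_bound_spectrum (A : H →L[ℂ] H) : ∃ M : ℝ, ∀ z ∈ spectrum ℂ A, ‖z‖ ≤ M :=
  ⟨‖A‖ * ‖(1 : H →L[ℂ] H)‖, fun _ hz => spectrum.norm_le_norm_mul_of_mem (𝕜 := ℂ) hz⟩

theorem exists_bound_sub (A : H →L[ℂ] H) (a : ℂ) :
    ∃ M, ∀ z, ‖(spectrum ℂ A).indicator (fun z => z - a) z‖ ≤ M := by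
  obtain ⟨M, hM⟩ := exists_bound_spectrum A
  refine norm_indicator_le (M := M + ‖a‖) fun z hz => ?_
  exact (_root_.norm_sub_le z a).trans (by gcongr; exact hM z hz)

theorem measurable_sub (A : H →L[ℂ] H) (a : ℂ) :
    Measurable ((spectrum ℂ A).indicator (fun z => z - a)) :=
  (measurable_id.sub_const a).indicator (spectrum.isClosed (𝕜 := ℂ) A).measurableSet

theorem sub_smul_one_eq (hE : E.IsSpectralMeasureOf A) (a : ℂ) :
    A - a • 1 = E.integral ((spectrum ℂ A).indicator fun z => z - a) := ext_quadratic fun x => by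
  obtain ⟨M, hM⟩ := exists_bound_spectrum A
  have hσ := (spectrum.isClosed (𝕜 := ℂ) A).measurableSet
  have hm : Measurable ((spectrum ℂ A).indicator fun z : ℂ => z) := measurable_id.indicator hσ
  have e : ⟪x, A x⟫_ℂ = ∫ z, (spectrum ℂ A).indicator (fun z => z) z ∂(E.scalarMeasure x) := by
    conv_lhs => rw [← hE.2]
    exact E.inner_integral hm (norm_indicator_le hM) x
  rw [E.inner_integral (measurable_sub A a) (exists_bound_sub A a), sub_apply, inner_sub_right,
    smul_apply, one_apply_eq_self, inner_smul_right, inner_self_eq_norm_sq_to_K, e]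
  have e2 : ∫ _, a ∂(E.scalarMeasure x) = a * ((‖x‖ : ℂ)) ^ 2 := by
    rw [integral_const, E.scalarMeasure_real_univ, Complex.real_smul, mul_comm]
    push_cast
    rfl
  change _ - a * (‖x‖ : ℂ) ^ 2 = _
  rw [← e2, ← integral_sub (integrable_of_bounded hm (norm_indicator_le hM)) (integrable_const a)]
  -- Off the spectrum the integrands are `-a` and `0`, but that set is null.
  refine integral_congr_ae ?_
  filter_upwards [E.ae_mem_of_proj_compl_eq_zero hσ (x := x) (by rw [hE.1]; rfl)] with z hz
  simp [hz]

theorem norm_sub_sq (hE : E.IsSpectralMeasureOf A) (a : ℂ) (x : H) :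
    ‖(A - a • 1) x‖ ^ 2
      = ∫ z, ‖(spectrum ℂ A).indicator (fun z => z - a) z‖ ^ 2 ∂(E.scalarMeasure x) := by
  rw [hE.sub_smul_one_eq, E.norm_integral_apply_sq (measurable_sub A a) (exists_bound_sub A a)]

theorem integrable_norm_sub_sq (A : H →L[ℂ] H) (a : ℂ) (μ : Measure ℂ) [IsFiniteMeasure μ] :
    Integrable (fun z => ‖(spectrum ℂ A).indicator (fun z => z - a) z‖ ^ 2) μ := by
  obtain ⟨M, hM⟩ := exists_bound_sub A a
  refine Integrable.of_bound ((measurable_sub A a).norm.pow_const 2).aestronglyMeasurable (M ^ 2)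
    (Filter.Eventually.of_forall fun z => ?_)
  rw [norm_pow, norm_norm]
  exact pow_le_pow_left₀ (norm_nonneg _) (hM z) 2

/-- Meant for `x` in the range of the projection of a closed ball about `a`, whose scalar measure
lives on that ball. -/
theorem norm_sub_le (hE : E.IsSpectralMeasureOf A) {a : ℂ} {r : ℝ} (hr : 0 ≤ r) {x : H}
    (h : ∀ᵐ z ∂(E.scalarMeasure x), ‖z - a‖ ≤ r) : ‖(A - a • 1) x‖ ≤ r * ‖x‖ := by
  refine (sq_le_sq₀ (norm_nonneg _) (by positivity)).mp ?_
  have e : (r * ‖x‖) ^ 2 = ∫ _, r ^ 2 ∂(E.scalarMeasure x) := by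
    rw [integral_const, E.scalarMeasure_real_univ, smul_eq_mul]
    ring
  rw [hE.norm_sub_sq, e]
  refine integral_mono_ae (integrable_norm_sub_sq A a _) (integrable_const _) ?_
  filter_upwards [h] with z hz
  refine pow_le_pow_left₀ (norm_nonneg _) ?_ 2
  exact (norm_indicator_le_norm_self _ z).trans hz

theorem le_norm_sub (hE : E.IsSpectralMeasureOf A) {a : ℂ} {r : ℝ} (hr : 0 ≤ r) {x : H}
    (h : ∀ᵐ z ∂(E.scalarMeasure x), r ≤ ‖z - a‖) : r * ‖x‖ ≤ ‖(A - a • 1) x‖ := by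
  refine (sq_le_sq₀ (by positivity) (norm_nonneg _)).mp ?_
  have e : (r * ‖x‖) ^ 2 = ∫ _, r ^ 2 ∂(E.scalarMeasure x) := by
    rw [integral_const, E.scalarMeasure_real_univ, smul_eq_mul]
    ring
  rw [hE.norm_sub_sq, e]
  refine integral_mono_ae (integrable_const _) (integrable_norm_sub_sq A a _) ?_
  -- Unlike the upper estimate, the lower one needs concentration on the spectrum, since the cut-off
  -- integrand vanishes elsewhere.
  filter_upwards [h, E.ae_mem_of_proj_compl_eq_zero (spectrum.isClosed (𝕜 := ℂ) A).measurableSet (x := x)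
    (by rw [hE.1]; rfl)] with z hz hzσ
  rw [Set.indicator_of_mem hzσ]
  exact pow_le_pow_left₀ hr hz 2

end IsSpectralMeasureOf

end SpectralMeasure

/-! ### Intertwining of spectral measures. -/

namespace SpectralMeasure

variable {H₁ H₂ : Type*} [NormedAddCommGroup H₁] [InnerProductSpace ℂ H₁] [CompleteSpace H₁]
  [NormedAddCommGroup H₂] [InnerProductSpace ℂ H₂]

theorem comp_proj_eq_zero_of_subset (E : SpectralMeasure H₁) {Y : H₁ →L[ℂ] H₂} {S Δ : Set ℂ}
    (hS : MeasurableSet S) (hΔ : MeasurableSet Δ) (hSΔ : S ⊆ Δ) (h : Y ∘L E Δ = 0) :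
    Y ∘L E S = 0 := by
  have e : E S = E Δ ∘L E S := by
    conv_lhs => rw [← Set.inter_eq_right.mpr hSΔ, E.proj_inter Δ S hΔ hS]
    rfl
  rw [e, ← ContinuousLinearMap.comp_assoc, h, ContinuousLinearMap.zero_comp]

/-- Countable additivity and continuity of `Y`, after making the sets disjoint. It serves to exhaust
an open ball by smaller closed balls. -/
theorem comp_proj_iUnion_eq_zero (E : SpectralMeasure H₁) {Y : H₁ →L[ℂ] H₂} {Δ : ℕ → Set ℂ}
    (hΔ : ∀ n, MeasurableSet (Δ n)) (h : ∀ n, Y ∘L E (Δ n) = 0) : Y ∘L E (⋃ n, Δ n) = 0 := by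
  ext x
  rw [← iUnion_disjointed]
  have h1 := Y.hasSum (E.proj_iUnion (disjointed Δ) (MeasurableSet.disjointed hΔ)
    (disjoint_disjointed Δ) x)
  have h2 : ∀ n, Y (E (disjointed Δ n) x) = 0 := fun n =>
    congrArg (fun D : H₁ →L[ℂ] H₂ => D x) (E.comp_proj_eq_zero_of_subset
      (MeasurableSet.disjointed hΔ n) (hΔ n) (disjointed_subset Δ n) (h n))
  simp only [h2] at h1
  exact h1.unique hasSum_zero

variable [CompleteSpace H₂] {E₁ : SpectralMeasure H₁} {E₂ : SpectralMeasure H₂} {B : H₁ →L[ℂ] H₁} {A : H₂ →L[ℂ] H₂}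
  {X : H₁ →L[ℂ] H₂}

/-- The compression `Y` satisfies `R ‖Y x‖ ≤ ‖(A - a) Y x‖ ≤ r ‖Y‖ ‖x‖`, and `r < R` leaves only `Y
= 0`. The intertwining of the adjoints plays no role here. -/
theorem proj_comp_comp_proj_eq_zero_of_lt (hE₁ : E₁.IsSpectralMeasureOf B)
    (hE₂ : E₂.IsSpectralMeasureOf A) (hX : X ∘L B = A ∘L X) {a : ℂ} {r R : ℝ} (hr : 0 ≤ r)
    (hrR : r < R) :
    (E₂ (Metric.ball a R)ᶜ ∘L X) ∘L E₁ (Metric.closedBall a r) = 0 := by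
  have hm₁ : MeasurableSet (Metric.closedBall a r) := Metric.isClosed_closedBall.measurableSet
  have hm₂ : MeasurableSet (Metric.ball a R) := Metric.isOpen_ball.measurableSet
  set P := E₂ (Metric.ball a R)ᶜ
  set Q := E₁ (Metric.closedBall a r)
  set Y := (P ∘L X) ∘L Q with hY
  have hPA : ∀ y, P (A y) = A (P y) := fun y => by
    have := E₂.integral_mul_proj ((measurable_id).indicator (spectrum.isClosed (𝕜 := ℂ) A).measurableSet)
      (norm_indicator_le (IsSpectralMeasureOf.exists_bound_spectrum A).choose_spec) hm₂.compl
    have e : E₂.integral ((spectrum ℂ A).indicator id) = A := hE₂.2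
    rw [e] at this
    exact (congrArg (fun D : H₂ →L[ℂ] H₂ => D y) this).symm
  have hQB : ∀ y, B (Q y) = Q (B y) := fun y => by
    have := E₁.integral_mul_proj ((measurable_id).indicator (spectrum.isClosed (𝕜 := ℂ) B).measurableSet)
      (norm_indicator_le (IsSpectralMeasureOf.exists_bound_spectrum B).choose_spec) hm₁
    have e : E₁.integral ((spectrum ℂ B).indicator id) = B := hE₁.2
    rw [e] at this
    exact congrArg (fun D : H₁ →L[ℂ] H₁ => D y) this
  have hXB : ∀ y, X (B y) = A (X y) := fun y => congrArg (fun D : H₁ →L[ℂ] H₂ => D y) hX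
  have hQQ : ∀ x, Q (Q x) = Q x := fun x =>
    congrArg (fun D : H₁ →L[ℂ] H₁ => D x) (E₁.proj_mul_self hm₁)
  -- The projection `Q` is used twice: one copy makes the upper estimate for `B - a` available, the
  -- other restores `Y`, so that `‖Y‖` occurs on both sides of the final inequality.
  have hYs : ∀ x, (A - a • 1) (Y x) = Y ((B - a • 1) (Q x)) := fun x => by
    simp [hY, ← hQB, hQQ, hXB, hPA]
  have hlow : ∀ x, R * ‖Y x‖ ≤ ‖(A - a • 1) (Y x)‖ := fun x => by
    refine hE₂.le_norm_sub (hr.trans hrR.le) ?_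
    filter_upwards [E₂.ae_mem_of_proj_compl_eq_zero hm₂.compl (x := Y x) (by
      rw [compl_compl]
      exact congrArg (fun D : H₂ →L[ℂ] H₂ => D (X (Q x))) (E₂.proj_mul_compl hm₂))] with z hz
    simpa [dist_eq_norm] using hz
  have hup : ∀ x, ‖(B - a • 1) (Q x)‖ ≤ r * ‖Q x‖ := fun x => by
    refine hE₁.norm_sub_le hr ?_
    filter_upwards [E₁.ae_mem_of_proj_compl_eq_zero hm₁ (x := Q x)
      (congrArg (fun D : H₁ →L[ℂ] H₁ => D x) (E₁.compl_mul_proj hm₁))] with z hz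
    simpa [dist_eq_norm] using hz
  have hQ1 : ∀ x, ‖Q x‖ ≤ ‖x‖ := fun x => by
    have h1 : ‖Q x‖ ^ 2 ≤ ‖x‖ ^ 2 := by
      have h2 := E₁.inner_proj x hm₁
      rw [E₁.inner_proj_eq_measureReal hm₁] at h2
      have h3 : (E₁.scalarMeasure x).real (Metric.closedBall a r) = ‖Q x‖ ^ 2 := by
        exact_mod_cast h2
      rw [← h3, ← E₁.scalarMeasure_real_univ x]
      exact measureReal_mono (Set.subset_univ _)
    exact (sq_le_sq₀ (norm_nonneg _) (norm_nonneg _)).mp h1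
  have hR : 0 < R := hr.trans_lt hrR
  have hnorm : ‖Y‖ ≤ r / R * ‖Y‖ := Y.opNorm_le_bound (by positivity) fun x => by
    have h1 : R * ‖Y x‖ ≤ ‖Y‖ * (r * ‖x‖) := by
      refine (hlow x).trans ?_
      rw [hYs]
      refine (Y.le_opNorm _).trans ?_
      gcongr
      exact (hup x).trans (by gcongr; exact hQ1 x)
    rw [div_mul_eq_mul_div, div_mul_eq_mul_div, le_div_iff₀ hR]
    linarith
  have h2 : r / R < 1 := (div_lt_one hR).mpr hrR
  have h3 : ‖Y‖ = 0 := by nlinarith [norm_nonneg Y]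
  exact norm_eq_zero.mp h3

theorem proj_comp_comp_proj_ball_eq_zero (hE₁ : E₁.IsSpectralMeasureOf B)
    (hE₂ : E₂.IsSpectralMeasureOf A) (hX : X ∘L B = A ∘L X) (a : ℂ) {R : ℝ} (hR : 0 < R) :
    (E₂ (Metric.ball a R)ᶜ ∘L X) ∘L E₁ (Metric.ball a R) = 0 := by
  -- The norm comparison needs a strict gap between the radii, so the open ball is exhausted by
  -- closed balls of radius `R (1 - 1 / (n + 1))`; the radius is `0` for `n = 0`.
  have hU : Metric.ball a R = ⋃ n : ℕ, Metric.closedBall a (R * (1 - 1 / (n + 1 : ℝ))) := by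
    ext z
    simp only [Metric.mem_ball, Set.mem_iUnion, Metric.mem_closedBall]
    constructor
    · intro hz
      obtain ⟨n, hn⟩ := exists_nat_one_div_lt (sub_pos.mpr ((div_lt_one hR).mpr hz))
      refine ⟨n, ?_⟩
      have h1 : dist z a / R ≤ 1 - 1 / (n + 1 : ℝ) := by linarith
      rw [div_le_iff₀ hR] at h1
      linarith
    · rintro ⟨n, hn⟩
      have : 0 < R * (1 / (n + 1 : ℝ)) := by positivity
      linarith
  have h := E₁.comp_proj_iUnion_eq_zero (Y := E₂ (Metric.ball a R)ᶜ ∘L X)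
    (Δ := fun n : ℕ => Metric.closedBall a (R * (1 - 1 / (n + 1 : ℝ))))
    (fun n => Metric.isClosed_closedBall.measurableSet) fun n => ?_
  · rwa [← hU] at h
  refine proj_comp_comp_proj_eq_zero_of_lt hE₁ hE₂ hX (mul_nonneg hR.le ?_) ?_
  · rw [sub_nonneg, div_le_one (by positivity)]
    linarith [n.cast_nonneg (α := ℝ)]
  · have : 0 < R * (1 / (n + 1 : ℝ)) := by positivity
    linarith

theorem comp_proj_ball_eq (hE₁ : E₁.IsSpectralMeasureOf B)
    (hE₂ : E₂.IsSpectralMeasureOf A) (hX : X ∘L B = A ∘L X) (a : ℂ) (R : ℝ) :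
    X ∘L E₁ (Metric.ball a R) = (E₂ (Metric.ball a R) ∘L X) ∘L E₁ (Metric.ball a R) := by
  rcases le_or_gt R 0 with hR | hR
  · rw [Metric.ball_eq_empty.mpr hR]
    ext x
    simp [proj_empty_apply]
  · have h := proj_comp_comp_proj_ball_eq_zero hE₁ hE₂ hX a hR
    rw [E₂.proj_compl Metric.isOpen_ball.measurableSet] at h
    ext x
    have h1 := congrArg (fun D : H₁ →L[ℂ] H₂ => D x) h
    exact sub_eq_zero.mp (by simpa using h1)

theorem adjoint_proj {Δ : Set ℂ} (E : SpectralMeasure H₁) (hΔ : MeasurableSet Δ) :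
    ContinuousLinearMap.adjoint (E Δ) = E Δ := by
  rw [← ContinuousLinearMap.star_eq_adjoint]
  exact (E.isStarProjection Δ hΔ).isSelfAdjoint.star_eq

/-- An operator which intertwines two normal operators and their adjoints intertwines their
spectral measures. -/
theorem comp_proj_eq_proj_comp (hE₁ : E₁.IsSpectralMeasureOf B)
    (hE₂ : E₂.IsSpectralMeasureOf A) (hX : X ∘L B = A ∘L X)
    (hX' : X ∘L ContinuousLinearMap.adjoint B = ContinuousLinearMap.adjoint A ∘L X)
    {Δ : Set ℂ} (hΔ : MeasurableSet Δ) : X ∘L E₁ Δ = E₂ Δ ∘L X := by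
  -- The hypothesis on adjoints says that `X*` intertwines in the opposite direction, so the
  -- one-sided result for balls applies to `X*` as well.
  have hXs : ContinuousLinearMap.adjoint X ∘L A = B ∘L ContinuousLinearMap.adjoint X := by
    have := congrArg ContinuousLinearMap.adjoint hX'
    simpa only [ContinuousLinearMap.adjoint_comp, ContinuousLinearMap.adjoint_adjoint] using this.symm
  have hball : ∀ a R, X ∘L E₁ (Metric.ball a R) = E₂ (Metric.ball a R) ∘L X := fun a R => by
    have hm : MeasurableSet (Metric.ball a R) := Metric.isOpen_ball.measurableSet
    have h1 := comp_proj_ball_eq hE₁ hE₂ hX a R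
    -- The result for `X` gives `X E₁ = E₂ X E₁`; the adjoint of the result for `X*` gives `E₂ X =
    -- E₂ X E₁`.
    have h2 := congrArg ContinuousLinearMap.adjoint (comp_proj_ball_eq hE₂ hE₁ hXs a R)
    simp only [ContinuousLinearMap.adjoint_comp, ContinuousLinearMap.adjoint_adjoint,
      adjoint_proj _ hm] at h2
    exact h1.trans ((ContinuousLinearMap.comp_assoc _ _ _).trans h2.symm)
  have hcompl : ∀ S, MeasurableSet S → X ∘L E₁ S = E₂ S ∘L X → X ∘L E₁ Sᶜ = E₂ Sᶜ ∘L X :=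
    fun S hS h => by
      rw [E₁.proj_compl hS, E₂.proj_compl hS, ContinuousLinearMap.comp_sub,
        ContinuousLinearMap.sub_comp, h]
      rfl
  have hinter : ∀ S S', MeasurableSet S → MeasurableSet S' → X ∘L E₁ S = E₂ S ∘L X →
      X ∘L E₁ S' = E₂ S' ∘L X → X ∘L E₁ (S ∩ S') = E₂ (S ∩ S') ∘L X := fun S S' hS hS' h h' => by
    rw [E₁.proj_inter S S' hS hS', E₂.proj_inter S S' hS hS']
    change X ∘L (E₁ S ∘L E₁ S') = (E₂ S ∘L E₂ S') ∘L X
    rw [← ContinuousLinearMap.comp_assoc, h, ContinuousLinearMap.comp_assoc, h',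
      ContinuousLinearMap.comp_assoc]
  have hb : TopologicalSpace.IsTopologicalBasis {S : Set ℂ | ∃ a R, S = Metric.ball a R} := by
    refine TopologicalSpace.isTopologicalBasis_of_isOpen_of_nhds ?_ fun a U ha hU => ?_
    · rintro _ ⟨a, R, rfl⟩
      exact Metric.isOpen_ball
    · obtain ⟨ε, hε, h⟩ := Metric.isOpen_iff.mp hU a ha
      exact ⟨_, ⟨a, ε, rfl⟩, Metric.mem_ball_self hε, h⟩
  have hgen := (BorelSpace.measurable_eq (α := ℂ)).trans hb.borel_eq_generateFrom
  -- Balls are not closed under intersection, so instead of a π-system argument the good sets are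
  -- shown to form a σ-algebra. Measurability is carried along because the laws of `E₁` and `E₂`
  -- hold only on Borel sets.
  have key : ∀ S, MeasurableSet[MeasurableSpace.generateFrom
      {S : Set ℂ | ∃ a R, S = Metric.ball a R}] S → MeasurableSet S ∧ X ∘L E₁ S = E₂ S ∘L X := by
    intro S hS
    induction S, hS using MeasurableSpace.generateFrom_induction with
    | hC S hS _ =>
      obtain ⟨a, R, rfl⟩ := hS
      exact ⟨Metric.isOpen_ball.measurableSet, hball a R⟩
    | empty =>
      refine ⟨.empty, ?_⟩
      ext x
      simp [proj_empty_apply]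
    | compl S _ h => exact ⟨h.1.compl, hcompl S h.1 h.2⟩
    | iUnion S _ h =>
      -- Disjointed sets arise from `S` by finitely many differences, that is, intersections with
      -- complements; countable additivity then applies.
      have hd : ∀ n, MeasurableSet (disjointed S n) ∧
          X ∘L E₁ (disjointed S n) = E₂ (disjointed S n) ∘L X := fun n => by
        refine disjointedRec (p := fun t => MeasurableSet t ∧ X ∘L E₁ t = E₂ t ∘L X)
          (fun t i ht => ?_) (h n)
        exact ⟨ht.1.diff (h i).1, hinter _ _ ht.1 (h i).1.compl ht.2 (hcompl _ (h i).1 (h i).2)⟩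
      refine ⟨.iUnion fun n => (h n).1, ?_⟩
      ext x
      rw [← iUnion_disjointed]
      have h1 := X.hasSum (E₁.proj_iUnion _ (fun n => (hd n).1) (disjoint_disjointed S) x)
      have h2 := E₂.proj_iUnion _ (fun n => (hd n).1) (disjoint_disjointed S) (X x)
      have h3 : ∀ n, X (E₁ (disjointed S n) x) = E₂ (disjointed S n) (X x) := fun n =>
        congrArg (fun D : H₁ →L[ℂ] H₂ => D x) (hd n).2
      simp only [h3] at h1
      exact h1.unique h2
  exact (key Δ (hgen ▸ hΔ)).2

/-- Clear for simple functions. The weak limit passes through `X` once `X` is moved to the other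
argument as `X*`. -/
theorem comp_integral_eq_integral_comp
    (hX : ∀ Δ, MeasurableSet Δ → X ∘L E₁ Δ = E₂ Δ ∘L X) {h : ℂ → ℂ} (hm : Measurable h)
    (hb : ∃ M, ∀ z, ‖h z‖ ≤ M) : X ∘L E₁.integral h = E₂.integral h ∘L X := by
  obtain ⟨s, M, hM, hs⟩ := exists_simpleFunc_tendsto hm hb
  have h1 : ∀ n y, X (E₁.integral (s n) y) = E₂.integral (s n) (X y) := fun n y => by
    simp only [integral_simpleFunc, sum_apply, smul_apply, map_sum, map_smul]
    refine Finset.sum_congr rfl fun c _ => ?_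
    exact congrArg (c • ·)
      (congrArg (fun D : H₁ →L[ℂ] H₂ => D y) (hX _ ((s n).measurableSet_fiber c)))
  ext y
  refine ext_inner_left ℂ fun x => ?_
  have h2 := E₁.tendsto_inner_integral (fun n => (s n).measurable) hM hs
    (ContinuousLinearMap.adjoint X x) y
  have h3 := E₂.tendsto_inner_integral (fun n => (s n).measurable) hM hs x (X y)
  simp only [ContinuousLinearMap.adjoint_inner_left, h1] at h2
  exact tendsto_nhds_unique h2 h3

end SpectralMeasure

/-! ### Krein space adjoints, normality, spectra and commutants. -/

namespace KreinSpace

section Adjoint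

variable {K₁ K₂ K₃ : Type*} [NormedAddCommGroup K₁] [NormedSpace ℂ K₁] [KreinSpace K₁]
  [NormedAddCommGroup K₂] [NormedSpace ℂ K₂] [KreinSpace K₂]
  [NormedAddCommGroup K₃] [NormedSpace ℂ K₃] [KreinSpace K₃]

theorem adjoint_comp (S : K₂ →L[ℂ] K₃) (T : K₁ →L[ℂ] K₂) :
    adjoint (S ∘L T) = adjoint T ∘L adjoint S :=
  ContinuousLinearMap.ext fun y => form_ext_right fun x => by
    simp only [ContinuousLinearMap.comp_apply, form_adjoint_right]

theorem adjoint_adjoint (T : K₁ →L[ℂ] K₂) : adjoint (adjoint T) = T :=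
  ContinuousLinearMap.ext fun y => form_ext_right fun x => by
    rw [form_adjoint_right, form_adjoint_left]

end Adjoint

section Transport

variable {K H : Type*} [NormedAddCommGroup K] [NormedSpace ℂ K] [KreinSpace K]
  [NormedAddCommGroup H] [InnerProductSpace ℂ H] [CompleteSpace H]

/-- If `T A = N T` and `N` commutes with `T T⁺`, then `T A⁺ = N⁺ T`. -/
theorem comp_adjoint_eq_of_comp_eq {T : H →L[ℂ] K} (hT : Function.Injective T) {N : K →L[ℂ] K}
    (hN : N ∈ commutant (T ∘L adjoint T)) {A : H →L[ℂ] H} (hA : ∀ x, T (A x) = N (T x)) (x : H) :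
    T (adjoint A x) = adjoint N (T x) := by
  have hTA : adjoint A ∘L adjoint T = adjoint T ∘L adjoint N := by
    rw [← adjoint_comp, ← adjoint_comp]
    exact congrArg adjoint (ContinuousLinearMap.ext hA)
  -- `T T⁺` is its own adjoint, so its commutant also contains `N⁺`.
  have hN' : (T ∘L adjoint T) ∘L adjoint N = adjoint N ∘L (T ∘L adjoint T) := by
    have h := congrArg adjoint (mem_commutant.mp hN)
    change adjoint ((T ∘L adjoint T) ∘L N) = adjoint (N ∘L (T ∘L adjoint T)) at h
    simp only [adjoint_comp, adjoint_adjoint] at h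
    exact h.symm
  -- On the range of `T⁺` one has `T A⁺ T⁺ = T T⁺ N⁺ = N⁺ T T⁺`; this range is dense.
  have h : (fun x => T (adjoint A x)) = fun x => adjoint N (T x) :=
    (denseRange_adjoint hT).equalizer (T.continuous.comp (adjoint A).continuous)
      ((adjoint N).continuous.comp T.continuous) (funext fun y => by
        have h1 := congrArg (fun D : K →L[ℂ] H => T (D y)) hTA
        have h2 := congrArg (fun D : K →L[ℂ] K => D y) hN'
        exact h1.trans h2)
  exact congrFun h x

/-- `T` carries `A* A` and `A A*` to `N⁺ N` and `N N⁺`, and `T` can be cancelled. -/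
theorem isStarNormal_of_comp_eq {T : H →L[ℂ] K} (hT : Function.Injective T) {N : K →L[ℂ] K}
    (hNN : N * adjoint N = adjoint N * N) (hN : N ∈ commutant (T ∘L adjoint T)) {A : H →L[ℂ] H}
    (hA : ∀ x, T (A x) = N (T x)) : IsStarNormal A := by
  have hA' := comp_adjoint_eq_of_comp_eq hT hN hA
  refine ⟨ContinuousLinearMap.ext fun x => hT ?_⟩
  rw [ContinuousLinearMap.star_eq_adjoint, ← adjoint_eq_hilbert_adjoint]
  simp only [mul_apply_eq_comp, hA, hA']
  exact congrArg (fun D : K →L[ℂ] K => D (T x)) hNN.symm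

/-- A bounded injective operator intertwining `B` and `A`, as well as their adjoints, yields
`σ(B) ⊆ σ(A)`. -/
theorem spectrum_subset_of_comp_eq {H₁ : Type*} [NormedAddCommGroup H₁] [InnerProductSpace ℂ H₁]
    [CompleteSpace H₁] {R : H₁ →L[ℂ] H} (hR : Function.Injective R) {A : H →L[ℂ] H}
    {B : H₁ →L[ℂ] H₁} (hAB : ∀ x, R (B x) = A (R x)) (hA : A ∈ commutant (R ∘L adjoint R)) :
    spectrum ℂ B ⊆ spectrum ℂ A := by
  intro z hz
  by_contra hzA
  rw [spectrum.mem_iff, not_not] at hzA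
  refine hz ?_
  obtain ⟨u, hu⟩ := hzA
  have hu' : (u : H →L[ℂ] H) ∈ commutant (R ∘L adjoint R) := by
    rw [hu]
    exact Subalgebra.sub_mem _ (Subalgebra.algebraMap_mem _ z) hA
  -- The resolvent of `A` again commutes with `R R*`, so it can be transported to `H₁`, where it
  -- inverts `z - B`.
  have hinv : ((u⁻¹ : (H →L[ℂ] H)ˣ) : H →L[ℂ] H) ∈ commutant (R ∘L adjoint R) :=
    mem_commutant.mpr (Commute.units_inv_right (mem_commutant.mp hu')).eq
  have hG := apply_transport R hR ⟨_, hinv⟩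
  set G : H₁ →L[ℂ] H₁ := (transport R hR ⟨_, hinv⟩).1
  have hRu : ∀ x, R ((algebraMap ℂ (H₁ →L[ℂ] H₁) z - B) x) = (u : H →L[ℂ] H) (R x) := fun x => by
    rw [hu]
    simp [Algebra.algebraMap_eq_smul_one, hAB]
  refine ⟨⟨algebraMap ℂ (H₁ →L[ℂ] H₁) z - B, G, ?_, ?_⟩, rfl⟩
  · refine ContinuousLinearMap.ext fun x => hR ?_
    rw [mul_apply_eq_comp, hRu, hG, ← mul_apply_eq_comp]
    simp
  · refine ContinuousLinearMap.ext fun x => hR ?_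
    rw [mul_apply_eq_comp, hG, hRu, ← mul_apply_eq_comp]
    simp

/-- A self-adjoint operator commuting with `A` commutes with the spectral measure of `A`. -/
theorem proj_mem_commutant {E : SpectralMeasure H} {A D : H →L[ℂ] H} (hE : E.IsSpectralMeasureOf A)
    (hD : adjoint D = D) (hA : A ∈ commutant D) {Δ : Set ℂ} (hΔ : MeasurableSet Δ) :
    E Δ ∈ commutant D := by
  rw [mem_commutant] at hA ⊢
  refine SpectralMeasure.comp_proj_eq_proj_comp hE hE hA ?_ hΔ
  -- Self-adjointness of `D` turns the adjoint of `D A = A D` into `D A* = A* D`, the second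
  -- intertwining relation.
  have h := congrArg adjoint hA
  change adjoint (D ∘L A) = adjoint (A ∘L D) at h
  rw [adjoint_comp, adjoint_comp, hD, adjoint_eq_hilbert_adjoint] at h
  exact h.symm

theorem integral_mem_commutant {E : SpectralMeasure H} {A D : H →L[ℂ] H}
    (hE : E.IsSpectralMeasureOf A) (hD : adjoint D = D) (hA : A ∈ commutant D) {h : ℂ → ℂ}
    (hm : Measurable h) (hb : ∃ M, ∀ z, ‖h z‖ ≤ M) : E.integral h ∈ commutant D :=
  mem_commutant.mpr (SpectralMeasure.comp_integral_eq_integral_comp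
    (fun _ hΔ => mem_commutant.mp (proj_mem_commutant hE hD hA hΔ)) hm hb)

theorem adjoint_comp_self (T : H →L[ℂ] K) :
    adjoint (adjoint T ∘L T) = adjoint T ∘L T := by
  rw [adjoint_comp, adjoint_adjoint]

theorem adjoint_self_comp (T : H →L[ℂ] K) :
    adjoint (T ∘L adjoint T) = T ∘L adjoint T := by
  rw [adjoint_comp, adjoint_adjoint]

end Transport

end KreinSpace

/-! ### Application to the operators induced by `N`. -/

theorem SpectralMeasure.measurable_indicator_of_domRestrict {S : Set ℂ} (hS : MeasurableSet S)
    {h : ℂ → ℂ} (hm : Measurable (S.domRestrict h)) : Measurable (S.indicator h) := by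
  refine measurable_of_restrict_of_restrict_compl hS ?_ ?_
  · have e : S.domRestrict (S.indicator h) = S.domRestrict h :=
      funext fun z => Set.indicator_of_mem z.2 h
    rwa [e]
  · have e : Sᶜ.domRestrict (S.indicator h) = fun _ => 0 :=
      funext fun z => Set.indicator_of_notMem z.2 h
    rw [e]
    exact measurable_const

theorem mainTheorem12 {K H : Type*} {m : ℕ} {Hs : Fin m → Type*}
    [NormedAddCommGroup K] [NormedSpace ℂ K] [KreinSpace K]
    [NormedAddCommGroup H] [InnerProductSpace ℂ H] [CompleteSpace H]
    [∀ j, NormedAddCommGroup (Hs j)] [∀ j, InnerProductSpace ℂ (Hs j)]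
    [∀ j, CompleteSpace (Hs j)]
    (T : H →L[ℂ] K) (Ts : ∀ j, Hs j →L[ℂ] K) (R : ∀ j, Hs j →L[ℂ] H)
    (hT : Function.Injective T) (hTs : ∀ j, Function.Injective (Ts j))
    (hR : ∀ j, Function.Injective (R j)) (hTR : ∀ j, T ∘L R j = Ts j)
    (j : Fin m) (N : K →L[ℂ] K)
    (hN : N * KreinSpace.adjoint N = KreinSpace.adjoint N * N)
    (hNj : N ∈ KreinSpace.commutant (Ts j ∘L KreinSpace.adjoint (Ts j)))
    (hNT : N ∈ KreinSpace.commutant (T ∘L KreinSpace.adjoint T)) :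
    let ΘN : H →L[ℂ] H := KreinSpace.transport T hT ⟨N, hNT⟩
    let ΘjN : Hs j →L[ℂ] Hs j := KreinSpace.transport (Ts j) (hTs j) ⟨N, hNj⟩
    let Γj : KreinSpace.commutant (R j ∘L KreinSpace.adjoint (R j)) →
        KreinSpace.commutant (KreinSpace.adjoint (R j) ∘L R j) :=
      KreinSpace.transport (R j) (hR j)
    let domH : Subalgebra ℂ (H →L[ℂ] H) :=
      KreinSpace.commutant (R j ∘L KreinSpace.adjoint (R j)) ⊓
        KreinSpace.commutant (KreinSpace.adjoint T ∘L T)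
    let domHj : Subalgebra ℂ (Hs j →L[ℂ] Hs j) :=
      KreinSpace.commutant (KreinSpace.adjoint (R j) ∘L R j) ⊓
        KreinSpace.commutant (KreinSpace.adjoint (Ts j) ∘L Ts j)
    spectrum ℂ ΘjN ⊆ spectrum ℂ ΘN ∧
    ∃ (hΘ : IsStarNormal ΘN) (hΘj : IsStarNormal ΘjN),
      let E : SpectralMeasure H := spectralMeasure ΘN hΘ
      let Ej : SpectralMeasure (Hs j) := spectralMeasure ΘjN hΘj
      (∀ Δ : Set ℂ, MeasurableSet Δ →
        ∃ hE : E Δ ∈ domH, (Γj ⟨E Δ, hE.1⟩ : Hs j →L[ℂ] Hs j) = Ej Δ ∧ Ej Δ ∈ domHj) ∧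
      (∀ h : ℂ → ℂ, Measurable ((spectrum ℂ ΘN).domRestrict h) →
        (∃ M : ℝ, ∀ z ∈ spectrum ℂ ΘN, ‖h z‖ ≤ M) →
        ∃ hI : E.integralOn (spectrum ℂ ΘN) h ∈ domH,
          (Γj ⟨E.integralOn (spectrum ℂ ΘN) h, hI.1⟩ : Hs j →L[ℂ] Hs j) =
            Ej.integralOn (spectrum ℂ ΘjN) h ∧
          Ej.integralOn (spectrum ℂ ΘjN) h ∈ domHj) := by
  intro ΘN ΘjN Γj domH domHj
  have hA : ∀ x, T (ΘN x) = N (T x) := KreinSpace.apply_transport T hT ⟨N, hNT⟩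
  have hB : ∀ x, Ts j (ΘjN x) = N (Ts j x) := KreinSpace.apply_transport (Ts j) (hTs j) ⟨N, hNj⟩
  have hAD : ΘN ∈ KreinSpace.commutant (KreinSpace.adjoint T ∘L T) :=
    (KreinSpace.transport T hT ⟨N, hNT⟩).2
  have hBD : ΘjN ∈ KreinSpace.commutant (KreinSpace.adjoint (Ts j) ∘L Ts j) :=
    (KreinSpace.transport (Ts j) (hTs j) ⟨N, hNj⟩).2
  have hΓ : ∀ C x, R j ((Γj C : Hs j →L[ℂ] Hs j) x) = (C : H →L[ℂ] H) (R j x) :=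
    KreinSpace.apply_transport (R j) (hR j)
  clear_value ΘN ΘjN Γj
  have hTRx : ∀ x, T (R j x) = Ts j x := fun x => congrArg (fun D : Hs j →L[ℂ] K => D x) (hTR j)
  have hRB : ∀ x, R j (ΘjN x) = ΘN (R j x) := fun x => hT (by rw [hTRx, hB, hA, hTRx])
  have hRB' : ∀ x, R j (KreinSpace.adjoint ΘjN x) = KreinSpace.adjoint ΘN (R j x) := fun x =>
    hT (by
      rw [hTRx, KreinSpace.comp_adjoint_eq_of_comp_eq (hTs j) hNj hB,
        KreinSpace.comp_adjoint_eq_of_comp_eq hT hNT hA, hTRx])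
  -- The adjoint of `R B* = A* R` is `B R* = R* A`. With `R B = A R` it yields `A R R* = R B R* = R
  -- R* A`, and likewise `B R* R = R* R B`.
  have hBR : ∀ y, ΘjN (KreinSpace.adjoint (R j) y) = KreinSpace.adjoint (R j) (ΘN y) := fun y => by
    have h := congrArg KreinSpace.adjoint
      (show R j ∘L KreinSpace.adjoint ΘjN = KreinSpace.adjoint ΘN ∘L R j from
        ContinuousLinearMap.ext hRB')
    simp only [KreinSpace.adjoint_comp, KreinSpace.adjoint_adjoint] at h
    exact congrArg (fun D : H →L[ℂ] Hs j => D y) h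
  have hAR : ΘN ∈ KreinSpace.commutant (R j ∘L KreinSpace.adjoint (R j)) :=
    KreinSpace.mem_commutant.mpr (ContinuousLinearMap.ext fun y => by
      simp only [mul_apply_eq_comp, ContinuousLinearMap.comp_apply, ← hBR, hRB])
  have hBRR : ΘjN ∈ KreinSpace.commutant (KreinSpace.adjoint (R j) ∘L R j) :=
    KreinSpace.mem_commutant.mpr (ContinuousLinearMap.ext fun y => by
      simp only [mul_apply_eq_comp, ContinuousLinearMap.comp_apply, hBR, hRB])
  have hσ := KreinSpace.spectrum_subset_of_comp_eq (hR j) hRB hAR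
  refine ⟨hσ, KreinSpace.isStarNormal_of_comp_eq hT hN hNT hA,
    KreinSpace.isStarNormal_of_comp_eq (hTs j) hN hNj hB, ?_⟩
  intro E Ej
  have hE : E.IsSpectralMeasureOf ΘN := isSpectralMeasureOf_spectralMeasure _ _
  have hEj : Ej.IsSpectralMeasureOf ΘjN := isSpectralMeasureOf_spectralMeasure _ _
  clear_value E Ej
  have hX : ∀ Δ, MeasurableSet Δ → R j ∘L Ej Δ = E Δ ∘L R j := fun Δ hΔ =>
    SpectralMeasure.comp_proj_eq_proj_comp hEj hE (ContinuousLinearMap.ext hRB) (by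
      rw [← KreinSpace.adjoint_eq_hilbert_adjoint, ← KreinSpace.adjoint_eq_hilbert_adjoint]
      exact ContinuousLinearMap.ext hRB') hΔ
  constructor
  · intro Δ hΔ
    refine ⟨⟨KreinSpace.proj_mem_commutant hE (KreinSpace.adjoint_self_comp _) hAR hΔ,
      KreinSpace.proj_mem_commutant hE (KreinSpace.adjoint_comp_self _) hAD hΔ⟩, ?_,
      KreinSpace.proj_mem_commutant hEj (KreinSpace.adjoint_comp_self _) hBRR hΔ,
      KreinSpace.proj_mem_commutant hEj (KreinSpace.adjoint_comp_self _) hBD hΔ⟩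
    refine ContinuousLinearMap.ext fun x => hR j ?_
    rw [hΓ]
    exact (congrArg (fun D : Hs j →L[ℂ] H => D x) (hX Δ hΔ)).symm
  · rintro h hm ⟨M, hM⟩
    have hSA := (spectrum.isClosed (𝕜 := ℂ) ΘN).measurableSet
    have hSB := (spectrum.isClosed (𝕜 := ℂ) ΘjN).measurableSet
    have hmA := SpectralMeasure.measurable_indicator_of_domRestrict hSA hm
    have hbA := SpectralMeasure.norm_indicator_le hM
    have hbB := SpectralMeasure.norm_indicator_le fun z hz => hM z (hσ hz)
    -- Measurability of `h` is assumed on the larger spectrum only; cutting off twice transfers it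
    -- to the smaller one.
    have e : (spectrum ℂ ΘjN).indicator ((spectrum ℂ ΘN).indicator h)
        = (spectrum ℂ ΘjN).indicator h := by
      rw [Set.indicator_indicator, Set.inter_eq_left.mpr hσ]
    have hmB : Measurable ((spectrum ℂ ΘjN).indicator h) := e ▸ hmA.indicator hSB
    -- Intertwining compares the integrals of one function on `ℂ`, while the two sides cut `h` off
    -- at different spectra. As `Ej` lives on the smaller one, the cut-off does not matter for it.
    have hI := Ej.integral_congr_of_proj_compl_eq_zero hmB hbB hmA hbA hSB hEj.1 fun z hz => by
      rw [Set.indicator_of_mem hz, Set.indicator_of_mem (hσ hz)]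
    refine ⟨⟨KreinSpace.integral_mem_commutant hE (KreinSpace.adjoint_self_comp _) hAR hmA hbA,
      KreinSpace.integral_mem_commutant hE (KreinSpace.adjoint_comp_self _) hAD hmA hbA⟩, ?_,
      KreinSpace.integral_mem_commutant hEj (KreinSpace.adjoint_comp_self _) hBRR hmB hbB,
      KreinSpace.integral_mem_commutant hEj (KreinSpace.adjoint_comp_self _) hBD hmB hbB⟩
    refine ContinuousLinearMap.ext fun x => hR j ?_
    rw [hΓ]
    change _ = R j (Ej.integral ((spectrum ℂ ΘjN).indicator h) x)
    rw [hI]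
    exact (congrArg (fun D : Hs j →L[ℂ] H => D x)
      (SpectralMeasure.comp_integral_eq_integral_comp hX hmA hbA)).symm
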